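/- Let $W:[-\pi,\pi]\to[0,\infty)$ be a measurable function with $\int_{-\pi}^{\pi}W(\theta)\,d\theta<\infty$ and $\int_{-\pi}^{\pi}|\log W(\theta)|\,d\theta<\infty$ (with $\log 0=-\infty$; in particular $W>0$ almost everywhere). Let $\mu$ be the measure on the unit circle $\mathbb T$ given by $d\mu(e^{i\theta})=W(\theta)\,\frac{d\theta}{2\pi}$ (Szegő class), and let $$D(\xi)=\exp\left[\frac1{4\pi}\int_{-\pi}^{\pi}\log W(\theta)\,\frac{1+\xi e^{-i\theta}}{1-\xi e^{-i\theta}}\,d\theta\right],\qquad |\xi|<1,$$ be its Szegő function. Let $(\varphi_j)_{j\ge 0}$ be polynomials with complex coefficients, $\deg\varphi_j=j$, that are orthonormal with respect to $\mu$: $\int_{\mathbb T}\varphi_j\overline{\varphi_k}\,d\mu=\delta_{jk}$ for all $j,k\ge 0$. For $k,l\ge0$ put $K_n^{(k,l)}(z,w)=\sum_{j=0}^n\varphi_j^{(k)}(z)\,\overline{\varphi_j^{(l)}(w)}$ and $K_n=K_n^{(0,0)}$, and for $v\in\mathbb C$ let $$\rho_{n,v}(z)=\frac1\pi\left[\frac{K_n^{(1,1)}(z,z)}{K_n(z,z)}-\frac{|K_n^{(0,1)}(z,z)|^2}{K_n(z,z)^2}\left(1-\frac{|v|^2}{K_n(z,z)}\right)\right]\exp\left(-\frac{|v|^2}{K_n(z,z)}\right),$$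 the density of the mean number of complex roots of the random equation $\sum_{j=0}^n\eta_j\varphi_j(z)=v$ with independent standard complex normal coefficients $\eta_j$. Then for every $v\in\mathbb C$, locally uniformly for $|z|<1$, $$\lim_{n\to\infty}\rho_{n,v}(z)=\frac1\pi\left(\frac1{(1-|z|^2)^2}+(1-|z|^2)\,|vD(z)|^2\left|\frac{z}{1-|z|^2}-\frac{\overline{D'(z)}}{\overline{D(z)}}\right|^2\right)\exp\left[-(1-|z|^2)\,|vD(z)|^2\right].$$ -/

import Mathlib

open MeasureTheory Filter Topology
open scoped ComplexConjugate Polynomial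

noncomputable section

namespace OPUC

/-- The unit circle carries its Borel sigma-algebra. -/
instance : MeasurableSpace Circle := borel Circle

instance : BorelSpace Circle := ⟨rfl⟩

/-- The derivatives `K_n^{(k,l)}(z, w) = ∑_{j=0}^n φ_j^{(k)}(z) * conj (φ_j^{(l)}(w))` of the
reproducing kernel; `k = l = 0` is the kernel `K_n` itself. -/
def kernel (φ : ℕ → ℂ[X]) (n k l : ℕ) (z w : ℂ) : ℂ :=
  ∑ j ∈ Finset.range (n + 1),
    (Polynomial.derivative^[k] (φ j)).eval z * conj ((Polynomial.derivative^[l] (φ j)).eval w)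

/-- The density `ρ_{n,v}(z)` of the mean number of complex roots of `Φ_n(z) = v`, where
`Φ_n = ∑_{j=0}^n η_j φ_j` and the `η_j` are i.i.d. standard complex normal.
The numbers `K_n(z,z)` and `K_n^{(1,1)}(z,z)` are sums of squared moduli, hence real, so that
taking the real part only changes their type. -/
def rho (φ : ℕ → ℂ[X]) (n : ℕ) (v z : ℂ) : ℝ :=
  (1 / Real.pi) *
    ((kernel φ n 1 1 z z).re / (kernel φ n 0 0 z z).re
      - ‖kernel φ n 0 1 z z‖ ^ 2 / (kernel φ n 0 0 z z).re ^ 2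
        * (1 - ‖v‖ ^ 2 / (kernel φ n 0 0 z z).re))
    * Real.exp (-(‖v‖ ^ 2 / (kernel φ n 0 0 z z).re))

/-- `φ` is a sequence of orthonormal polynomials on the unit circle with respect to the
(finite Borel) measure `μ`. No choice of the argument of the leading coefficients is imposed. -/
structure IsOrthonormal (μ : Measure Circle) (φ : ℕ → ℂ[X]) : Prop where
  degree_eq : ∀ j : ℕ, (φ j).degree = (j : WithBot ℕ)
  orthonormal : ∀ j k : ℕ,
    ∫ ζ : Circle, (φ j).eval (ζ : ℂ) * conj ((φ k).eval (ζ : ℂ)) ∂μ = if j = k then 1 else 0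

/-- The measure `μ` on the unit circle belongs to the Szegő class with weight `W`:
`dμ(e^{iθ}) = W(θ) dθ / (2π)`, with `W ≥ 0`, `∫ W < ∞` and `∫ |log W| < ∞` on `[-π, π]`.
Finiteness of `∫ |log W|`, where `log 0 = -∞`, says that `W > 0` almost everywhere and that the
real-valued function `log W` is integrable; since `Real.log 0 = 0`, both parts are spelled out. -/
structure IsSzegoClass (μ : Measure Circle) (W : ℝ → ℝ) : Prop where
  integrable : IntegrableOn W (Set.Ioc (-Real.pi) Real.pi)
  pos : ∀ᵐ θ ∂(volume.restrict (Set.Ioc (-Real.pi) Real.pi)), 0 < W θ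
  log_integrable : IntegrableOn (fun θ => Real.log (W θ)) (Set.Ioc (-Real.pi) Real.pi)
  eq_map : μ = Measure.map Circle.exp
    ((volume.restrict (Set.Ioc (-Real.pi) Real.pi)).withDensity
      (fun θ => ENNReal.ofReal (W θ / (2 * Real.pi))))

/-- The Szegő function `D` of the weight `W`. -/
def szegoFunction (W : ℝ → ℝ) (ξ : ℂ) : ℂ :=
  Complex.exp ((1 / (4 * Real.pi : ℂ)) *
    ∫ θ in (-Real.pi)..Real.pi,
      (Real.log (W θ) : ℂ) *
        ((1 + ξ * Complex.exp (-(θ * Complex.I))) / (1 - ξ * Complex.exp (-(θ * Complex.I)))))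

end OPUC

end

noncomputable section

namespace OPUC

/-! View `(φ_j(z))_j` as a vector of ℓ²; then `K_n(z,w)` is the inner product of truncations of two
such vectors. The crux is their limit `1 / ((1 - z w̄) D(z) conj D(w))`, proved in `inner_evalSeq`.
A bound `C` on all square sums of `a φ_j(z) + b φ_j(w)` amounts to `|a p(z) + b p(w)|² ≤ C ∫ |p|²
dμ` for all polynomials `p`. Such a bound survives multiplying `p` by an outer function
(`norm_sq_outer_le`), since outer functions are, up to unimodular constants, limits of exponentials
of polynomials. Multiplication by `D` carries bounds from arc length, with orthonormal polynomials
`z^j`, to `μ`, in the form needed for `D(z) φ_j(z)`; multiplication by `1/D` carries them back. So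
all two-point combinations of the vectors `(D(z) φ_j(z))_j` have the same norms as those of
`(z^j)_j`, and polarization gives the kernel. Moreover `K_n(z,z)` increases to a continuous limit,
so by Dini the truncated vectors converge in ℓ² locally uniformly on the disk. They are holomorphic
in `z`, hence their derivatives converge too, and the `K_n^{(k,l)}` with `k, l ≤ 1` tend to the
derivatives of the limit kernel (`inner_deriv_left`, `inner_deriv_deriv`). The rest is algebra. -/

/-- The normalized arc length measure on the unit circle. -/
def circleMeasure : Measure Circle :=
  Measure.map Circle.exp
    (ENNReal.ofReal (1 / (2 * Real.pi)) • volume.restrict (Set.Ioc (-Real.pi) Real.pi))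

/-- The Schwarz integral of a function on the unit circle. -/
def schwarzIntegral (g : Circle → ℝ) (ξ : ℂ) : ℂ :=
  ∫ ζ : Circle, (g ζ : ℂ) * ((1 + ξ * conj (ζ : ℂ)) / (1 - ξ * conj (ζ : ℂ))) ∂circleMeasure

/-- The outer function on the unit disk whose squared modulus on the circle is `exp g`. -/
def outer (g : Circle → ℝ) (ξ : ℂ) : ℂ := Complex.exp (schwarzIntegral g ξ / 2)

/-! ### Arc length and the orthonormality of monomials. -/

lemma measurable_coe_circle : Measurable fun ζ : Circle => (ζ : ℂ) :=
  Continuous.measurable (α := Circle) continuous_subtype_val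

lemma measurable_conj_circle : Measurable fun ζ : Circle => conj (ζ : ℂ) :=
  Complex.continuous_conj.measurable.comp measurable_coe_circle

lemma integral_circleMeasure {E : Type*} [NormedAddCommGroup E] [NormedSpace ℝ E] {f : Circle → E}
    (hf : AEStronglyMeasurable f circleMeasure) :
    ∫ ζ, f ζ ∂circleMeasure =
      (1 / (2 * Real.pi)) • ∫ θ in Set.Ioc (-Real.pi) Real.pi, f (Circle.exp θ) := by
  have h0 : (0 : ℝ) ≤ 1 / (2 * Real.pi) := by positivity
  rw [circleMeasure, integral_map Circle.exp.continuous.aemeasurable hf, integral_smul_measure,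
    ENNReal.toReal_ofReal h0]

instance : IsProbabilityMeasure circleMeasure := by
  have h : IsProbabilityMeasure (ENNReal.ofReal (1 / (2 * Real.pi)) •
      volume.restrict (Set.Ioc (-Real.pi) Real.pi)) := by
    constructor
    have hpi := Real.pi_pos
    rw [Measure.smul_apply, Measure.restrict_apply_univ, Real.volume_Ioc, smul_eq_mul,
      ← ENNReal.ofReal_mul (by positivity)]
    rw [show 1 / (2 * Real.pi) * (Real.pi - -Real.pi) = 1 by field_simp; ring, ENNReal.ofReal_one]
  exact Measure.isProbabilityMeasure_map Circle.exp.continuous.aemeasurable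

lemma integral_zpow_circleMeasure (n : ℤ) :
    ∫ ζ : Circle, (ζ : ℂ) ^ n ∂circleMeasure = if n = 0 then 1 else 0 := by
  have hc : Continuous fun ζ : Circle => (ζ : ℂ) ^ n :=
    continuous_subtype_val.zpow₀ n fun ζ => Or.inl (Circle.coe_ne_zero ζ)
  split_ifs with hn
  · simp [hn]
  · rw [integral_circleMeasure hc.aestronglyMeasurable,
      ← intervalIntegral.integral_of_le (by linarith [Real.pi_pos])]
    have h : ∀ θ : ℝ, ((Circle.exp θ : Circle) : ℂ) ^ n = Complex.exp ((n * Complex.I) * θ) := by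
      intro θ
      rw [Circle.coe_exp, ← Complex.exp_int_mul]
      ring_nf
    have hne : (n * Complex.I : ℂ) ≠ 0 := by simp [hn]
    simp_rw [h]
    rw [integral_exp_mul_complex hne]
    have : Complex.exp (n * Complex.I * ((Real.pi : ℝ) : ℂ))
        = Complex.exp (n * Complex.I * ((-Real.pi : ℝ) : ℂ)) := by
      rw [Complex.exp_eq_exp_iff_exists_int]
      exact ⟨n, by push_cast; ring⟩
    rw [this]; simp

lemma conj_coe_circle (ζ : Circle) : conj (ζ : ℂ) = (ζ : ℂ)⁻¹ := by
  rw [← Circle.coe_inv_eq_conj, Circle.coe_inv]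

lemma isOrthonormal_X_pow : IsOrthonormal circleMeasure fun j => (Polynomial.X : ℂ[X]) ^ j := by
  refine ⟨fun j => by simp, fun j k => ?_⟩
  have h : ∀ ζ : Circle, ((Polynomial.X : ℂ[X]) ^ j).eval (ζ : ℂ) *
      conj (((Polynomial.X : ℂ[X]) ^ k).eval (ζ : ℂ)) = (ζ : ℂ) ^ ((j : ℤ) - k) := by
    intro ζ
    simp [conj_coe_circle, zpow_sub₀ (Circle.coe_ne_zero ζ), div_eq_mul_inv]
  simp_rw [h, integral_zpow_circleMeasure, sub_eq_zero, Nat.cast_inj]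

/-! ### Moving the weight from angles to the circle. -/

/-- The weight of a measure in the Szegő class, as a positive function on the circle. -/
structure IsSzegoDensity (μ : Measure Circle) (ω : Circle → ℝ) : Prop where
  measurable : Measurable ω
  pos : ∀ ζ, 0 < ω ζ
  integrable : Integrable ω circleMeasure
  log_integrable : Integrable (fun ζ => Real.log (ω ζ)) circleMeasure
  eq_withDensity : μ = circleMeasure.withDensity fun ζ => ENNReal.ofReal (ω ζ)

/-- A Szegő class measure has an everywhere positive measurable density. -/
lemma IsSzegoClass.exists_density {μ : Measure Circle} {W : ℝ → ℝ} (h : IsSzegoClass μ W) :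
    ∃ w : Circle → ℝ, IsSzegoDensity μ w ∧
      ∀ ξ, szegoFunction W ξ = outer (fun ζ => Real.log (w ζ)) ξ := by
  have hWm := h.integrable.aestronglyMeasurable.aemeasurable
  set W₁ : ℝ → ℝ := hWm.mk W with hW₁
  have hW₁m : Measurable W₁ := hWm.measurable_mk
  -- Changing the weight to `1` on the null set where it is not positive makes `exp (log ω) = ω`
  -- hold everywhere.
  set W₂ : ℝ → ℝ := fun θ => if 0 < W₁ θ then W₁ θ else 1 with hW₂
  have hW₂m : Measurable W₂ :=
    Measurable.ite (measurableSet_lt measurable_const hW₁m) hW₁m measurable_const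
  have hW₂pos : ∀ θ, 0 < W₂ θ := by
    intro θ
    simp only [hW₂]
    split_ifs with h1
    · exact h1
    · exact one_pos
  have hWW₂ : W =ᵐ[volume.restrict (Set.Ioc (-Real.pi) Real.pi)] W₂ := by
    filter_upwards [hWm.ae_eq_mk, h.pos] with θ h1 h2
    rw [h1] at h2
    simp only [hW₂, hW₁]
    rw [if_pos h2, h1]
  have harg : Measurable fun ζ : Circle => Complex.arg (ζ : ℂ) :=
    Complex.measurable_arg.comp measurable_coe_circle
  set w : Circle → ℝ := fun ζ => W₂ (Complex.arg ζ) with hw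
  have hwm : Measurable w := hW₂m.comp harg
  have hexp : ∀ θ ∈ Set.Ioc (-Real.pi) Real.pi, w (Circle.exp θ) = W₂ θ := by
    intro θ hθ
    simp only [hw]
    rw [Circle.arg_exp hθ.1 hθ.2]
  have hae : (fun θ => w (Circle.exp θ)) =ᵐ[volume.restrict (Set.Ioc (-Real.pi) Real.pi)] W := by
    filter_upwards [hWW₂, ae_restrict_mem measurableSet_Ioc] with θ h1 h2
    rw [hexp θ h2, h1]
  have hcne : ENNReal.ofReal (1 / (2 * Real.pi)) ≠ ⊤ := ENNReal.ofReal_ne_top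
  refine ⟨w, ⟨hwm, fun ζ => hW₂pos _, ?_, ?_, ?_⟩, ?_⟩
  · rw [circleMeasure, integrable_map_measure hwm.aestronglyMeasurable
      Circle.exp.continuous.aemeasurable]
    exact (h.integrable.congr hae.symm).smul_measure hcne
  · rw [circleMeasure, integrable_map_measure hwm.log.aestronglyMeasurable
      Circle.exp.continuous.aemeasurable]
    refine Integrable.smul_measure (Integrable.congr h.log_integrable ?_) hcne
    filter_upwards [hae] with θ h1
    simp [h1]
  · have hwe : Measurable fun θ => ENNReal.ofReal (w (Circle.exp θ)) :=
      hwm.ennreal_ofReal.comp Circle.exp.continuous.measurable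
    rw [h.eq_map, circleMeasure]
    ext s hs
    rw [withDensity_apply _ hs, Measure.map_apply Circle.exp.continuous.measurable hs,
      withDensity_apply _ (Circle.exp.continuous.measurable hs),
      setLIntegral_map hs hwm.ennreal_ofReal Circle.exp.continuous.measurable,
      Measure.restrict_smul, lintegral_smul_measure, smul_eq_mul,
      ← lintegral_const_mul _ hwe]
    refine lintegral_congr_ae (ae_restrict_of_ae ?_)
    filter_upwards [hae] with θ h1
    rw [h1, ← ENNReal.ofReal_mul (by positivity)]
    congr 1
    ring
  · intro ξ
    have hm : AEStronglyMeasurable (fun ζ : Circle => (Real.log (w ζ) : ℂ) *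
        ((1 + ξ * conj (ζ : ℂ)) / (1 - ξ * conj (ζ : ℂ)))) circleMeasure := by
      have h2 := measurable_conj_circle
      exact ((Complex.measurable_ofReal.comp hwm.log).mul
        (((h2.const_mul ξ).const_add 1).div ((h2.const_mul ξ).const_sub 1))).aestronglyMeasurable
    rw [szegoFunction, outer, schwarzIntegral, integral_circleMeasure hm,
      intervalIntegral.integral_of_le (by linarith [Real.pi_pos])]
    congr 1
    have : ∫ θ in Set.Ioc (-Real.pi) Real.pi, (Real.log (W θ) : ℂ) *
        ((1 + ξ * Complex.exp (-(θ * Complex.I))) / (1 - ξ * Complex.exp (-(θ * Complex.I))))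
        = ∫ θ in Set.Ioc (-Real.pi) Real.pi, (Real.log (w (Circle.exp θ)) : ℂ) *
          ((1 + ξ * conj (Circle.exp θ : ℂ)) / (1 - ξ * conj (Circle.exp θ : ℂ))) := by
      refine integral_congr_ae ?_
      filter_upwards [hae] with θ h1
      rw [h1, conj_coe_circle, Circle.coe_exp, Complex.exp_neg]
    -- The prefactor `1/(4π)` is the normalization `1/(2π)` times the `1/2` in `outer`.
    rw [this, Complex.real_smul]
    push_cast
    ring

/-! ### Cauchy and Schwarz integrals: expansion, holomorphy, stability. -/

lemma norm_mul_conj_circle (ξ : ℂ) (ζ : Circle) : ‖ξ * conj (ζ : ℂ)‖ = ‖ξ‖ := by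
  rw [norm_mul, RCLike.norm_conj, Circle.norm_coe, mul_one]

lemma one_sub_mul_conj_circle_ne_zero {ξ : ℂ} (hξ : ‖ξ‖ < 1) (ζ : Circle) :
    1 - ξ * conj (ζ : ℂ) ≠ 0 := by
  intro h
  have h1 := norm_mul_conj_circle ξ ζ
  rw [← sub_eq_zero.mp h, norm_one] at h1
  linarith

/-- The Taylor expansion of the Cauchy transform. -/
lemma hasSum_cauchyTransform {f : Circle → ℂ} (hf : Integrable f circleMeasure) {ξ : ℂ}
    (hξ : ‖ξ‖ < 1) :
    HasSum (fun j : ℕ => ξ ^ j * ∫ ζ : Circle, f ζ * conj (ζ : ℂ) ^ j ∂circleMeasure)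
      (∫ ζ : Circle, f ζ * (1 / (1 - ξ * conj (ζ : ℂ))) ∂circleMeasure) := by
  have hint : ∀ j : ℕ, Integrable (fun ζ : Circle => f ζ * (ξ * conj (ζ : ℂ)) ^ j)
      circleMeasure := by
    intro j
    refine hf.mul_bdd (c := ‖ξ‖ ^ j)
      ((measurable_conj_circle.const_mul ξ).pow_const j).aestronglyMeasurable
      (ae_of_all _ fun ζ => ?_)
    rw [norm_pow, norm_mul_conj_circle]
  have hsum : Summable fun j : ℕ =>
      ∫ ζ : Circle, ‖f ζ * (ξ * conj (ζ : ℂ)) ^ j‖ ∂circleMeasure := by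
    simp_rw [norm_mul _ (_ ^ _), norm_pow, norm_mul_conj_circle, integral_mul_const]
    exact (summable_geometric_of_lt_one (norm_nonneg _) hξ).mul_left _
  have h := hasSum_integral_of_summable_integral_norm hint hsum
  have h1 : ∀ j : ℕ, ∫ ζ : Circle, f ζ * (ξ * conj (ζ : ℂ)) ^ j ∂circleMeasure =
      ξ ^ j * ∫ ζ : Circle, f ζ * conj (ζ : ℂ) ^ j ∂circleMeasure := by
    intro j
    rw [← integral_const_mul]
    refine integral_congr_ae (ae_of_all _ fun ζ => ?_)
    simp only
    ring
  have h2 : ∀ ζ : Circle, ∑' j : ℕ, f ζ * (ξ * conj (ζ : ℂ)) ^ j =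
      f ζ * (1 / (1 - ξ * conj (ζ : ℂ))) := by
    intro ζ
    rw [tsum_mul_left, tsum_geometric_of_norm_lt_one (by rwa [norm_mul_conj_circle]), one_div]
  simpa only [h1, h2] using h

lemma integrable_mul_cauchyKernel {f : Circle → ℂ} (hf : Integrable f circleMeasure) {ξ : ℂ}
    (hξ : ‖ξ‖ < 1) :
    Integrable (fun ζ : Circle => f ζ * (1 / (1 - ξ * conj (ζ : ℂ)))) circleMeasure := by
  refine hf.mul_bdd (c := 1 / (1 - ‖ξ‖))
    ((measurable_conj_circle.const_mul ξ).const_sub 1 |>.const_div 1).aestronglyMeasurable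
    (ae_of_all _ fun ζ => ?_)
  rw [norm_div, norm_one]
  have h1 : 1 - ‖ξ‖ ≤ ‖1 - ξ * conj (ζ : ℂ)‖ := by
    have := norm_sub_norm_le (1 : ℂ) (ξ * conj (ζ : ℂ))
    rwa [norm_one, norm_mul_conj_circle] at this
  exact one_div_le_one_div_of_le (by linarith) h1

/-- The identity `(1+x)/(1-x) = 2/(1-x) - 1` reduces the Schwarz kernel to the Cauchy kernel. -/
lemma mul_herglotzKernel (c : ℂ) {ξ : ℂ} (hξ : ‖ξ‖ < 1) (ζ : Circle) :
    c * ((1 + ξ * conj (ζ : ℂ)) / (1 - ξ * conj (ζ : ℂ))) =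
      2 * (c * (1 / (1 - ξ * conj (ζ : ℂ)))) - c := by
  have := one_sub_mul_conj_circle_ne_zero hξ ζ
  field_simp
  ring

lemma integrable_mul_herglotzKernel {f : Circle → ℂ} (hf : Integrable f circleMeasure) {ξ : ℂ}
    (hξ : ‖ξ‖ < 1) :
    Integrable (fun ζ : Circle => f ζ * ((1 + ξ * conj (ζ : ℂ)) / (1 - ξ * conj (ζ : ℂ))))
      circleMeasure := by
  simp_rw [mul_herglotzKernel _ hξ]
  exact ((integrable_mul_cauchyKernel hf hξ).const_mul 2).sub hf

/-- The Taylor expansion of the Schwarz integral. -/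
lemma schwarzIntegral_eq_tsum {g : Circle → ℝ} (hg : Integrable g circleMeasure) {ξ : ℂ}
    (hξ : ‖ξ‖ < 1) :
    schwarzIntegral g ξ =
      2 * (∑' j : ℕ, ξ ^ j * ∫ ζ : Circle, (g ζ : ℂ) * conj (ζ : ℂ) ^ j ∂circleMeasure)
        - ∫ ζ : Circle, (g ζ : ℂ) ∂circleMeasure := by
  have hgc : Integrable (fun ζ => (g ζ : ℂ)) circleMeasure := hg.ofReal
  rw [(hasSum_cauchyTransform hgc hξ).tsum_eq, schwarzIntegral, ← integral_const_mul,
    ← integral_sub ((integrable_mul_cauchyKernel hgc hξ).const_mul 2) hgc]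
  simp_rw [mul_herglotzKernel _ hξ]

lemma differentiableOn_schwarzIntegral {g : Circle → ℝ} (hg : Integrable g circleMeasure) :
    DifferentiableOn ℂ (schwarzIntegral g) (Metric.ball 0 1) := by
  intro ξ₀ hξ₀
  obtain ⟨r, hr₀, hr₁⟩ := exists_between (mem_ball_zero_iff.mp hξ₀)
  have hr0 : 0 ≤ r := (norm_nonneg _).trans hr₀.le
  have hgc : Integrable (fun ζ => (g ζ : ℂ)) circleMeasure := hg.ofReal
  have key : DifferentiableOn ℂ (fun ξ : ℂ => ∑' j : ℕ,
      ξ ^ j * ∫ ζ : Circle, (g ζ : ℂ) * conj (ζ : ℂ) ^ j ∂circleMeasure) (Metric.ball 0 r) := by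
    refine Complex.differentiableOn_tsum_of_summable_norm
      (u := fun j => r ^ j * ∫ ζ : Circle, ‖(g ζ : ℂ)‖ ∂circleMeasure)
      ((summable_geometric_of_lt_one hr0 hr₁).mul_right _)
      (fun j => by fun_prop) Metric.isOpen_ball fun j ξ hξ => ?_
    rw [norm_mul, norm_pow]
    refine mul_le_mul (pow_le_pow_left₀ (norm_nonneg _) (mem_ball_zero_iff.mp hξ).le _) ?_
      (norm_nonneg _) (by positivity)
    refine (norm_integral_le_integral_norm _).trans (le_of_eq ?_)
    refine integral_congr_ae (ae_of_all _ fun ζ => ?_)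
    simp only
    rw [norm_mul, norm_pow, RCLike.norm_conj, Circle.norm_coe, one_pow, mul_one]
  have hmem : ξ₀ ∈ Metric.ball (0 : ℂ) r := mem_ball_zero_iff.mpr hr₀
  have h2 : DifferentiableAt ℂ (fun ξ : ℂ => 2 * (∑' j : ℕ,
      ξ ^ j * ∫ ζ : Circle, (g ζ : ℂ) * conj (ζ : ℂ) ^ j ∂circleMeasure)
        - ∫ ζ : Circle, (g ζ : ℂ) ∂circleMeasure) ξ₀ :=
    ((key.differentiableAt (Metric.isOpen_ball.mem_nhds hmem)).const_mul 2).sub_const _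
  refine (h2.congr_of_eventuallyEq ?_).differentiableWithinAt
  filter_upwards [Metric.isOpen_ball.mem_nhds hξ₀] with ξ hξ
  exact schwarzIntegral_eq_tsum hg (mem_ball_zero_iff.mp hξ)

lemma differentiableOn_outer {g : Circle → ℝ} (hg : Integrable g circleMeasure) :
    DifferentiableOn ℂ (outer g) (Metric.ball 0 1) :=
  ((differentiableOn_schwarzIntegral hg).div_const 2).cexp

lemma outer_ne_zero (g : Circle → ℝ) (ξ : ℂ) : outer g ξ ≠ 0 := Complex.exp_ne_zero _

/-- The Schwarz kernel is at most `2/(1-|ξ|)` on the circle. Hence mean convergence of the data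
gives pointwise convergence of the outer functions, as used in `tendsto_outer`. -/
lemma norm_schwarzIntegral_sub_le {g₁ g₂ : Circle → ℝ} (h₁ : Integrable g₁ circleMeasure)
    (h₂ : Integrable g₂ circleMeasure) {ξ : ℂ} (hξ : ‖ξ‖ < 1) :
    ‖schwarzIntegral g₁ ξ - schwarzIntegral g₂ ξ‖ ≤
      2 / (1 - ‖ξ‖) * ∫ ζ, |g₁ ζ - g₂ ζ| ∂circleMeasure := by
  have h₁' : Integrable (fun ζ => (g₁ ζ : ℂ)) circleMeasure := h₁.ofReal
  have h₂' : Integrable (fun ζ => (g₂ ζ : ℂ)) circleMeasure := h₂.ofReal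
  rw [schwarzIntegral, schwarzIntegral, ← integral_sub (integrable_mul_herglotzKernel h₁' hξ)
    (integrable_mul_herglotzKernel h₂' hξ), ← integral_const_mul]
  refine norm_integral_le_of_norm_le ((h₁.sub h₂).abs.const_mul _) (ae_of_all _ fun ζ => ?_)
  have hk : ‖(1 + ξ * conj (ζ : ℂ)) / (1 - ξ * conj (ζ : ℂ))‖ ≤ 2 / (1 - ‖ξ‖) := by
    rw [norm_div]
    have h1 : 1 - ‖ξ‖ ≤ ‖1 - ξ * conj (ζ : ℂ)‖ := by
      have := norm_sub_norm_le (1 : ℂ) (ξ * conj (ζ : ℂ))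
      rwa [norm_one, norm_mul_conj_circle] at this
    have h2 : ‖1 + ξ * conj (ζ : ℂ)‖ ≤ 2 := by
      have := norm_add_le (1 : ℂ) (ξ * conj (ζ : ℂ))
      rw [norm_one, norm_mul_conj_circle] at this
      linarith
    exact div_le_div₀ (by norm_num) h2 (by linarith) h1
  rw [← sub_mul, norm_mul, mul_comm, ← Complex.ofReal_sub, Complex.norm_real, Real.norm_eq_abs]
  exact mul_le_mul_of_nonneg_right hk (abs_nonneg _)

/-! ### Real parts of polynomials: Schwarz integral and density. -/

lemma continuous_eval_circle (q : ℂ[X]) : Continuous fun ζ : Circle => q.eval (ζ : ℂ) :=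
  q.continuous.comp continuous_subtype_val

lemma integrable_of_continuous {E : Type*} [NormedAddCommGroup E] {ν : Measure Circle}
    [IsFiniteMeasure ν] {f : Circle → E} (hf : Continuous f) : Integrable f ν :=
  hf.integrable_of_hasCompactSupport (HasCompactSupport.of_compactSpace f)

lemma integrable_re_eval (ν : Measure Circle) [IsFiniteMeasure ν] (q : ℂ[X]) :
    Integrable (fun ζ : Circle => (q.eval (ζ : ℂ)).re) ν :=
  integrable_of_continuous (Complex.continuous_re.comp (continuous_eval_circle q))

/-- The Schwarz integral recovers a polynomial from its real part. -/
lemma schwarzIntegral_re_eval (q : ℂ[X]) {ξ : ℂ} (hξ : ‖ξ‖ < 1) :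
    schwarzIntegral (fun ζ => (q.eval (ζ : ℂ)).re) ξ = q.eval ξ - (q.eval 0).im * Complex.I := by
  induction q using Polynomial.induction_on' with
  | add p q hp hq =>
    have h : schwarzIntegral (fun ζ => ((p + q).eval (ζ : ℂ)).re) ξ =
        schwarzIntegral (fun ζ => (p.eval (ζ : ℂ)).re) ξ +
          schwarzIntegral (fun ζ => (q.eval (ζ : ℂ)).re) ξ := by
      have hp' : Integrable (fun ζ : Circle => ((p.eval (ζ : ℂ)).re : ℂ)) circleMeasure :=
        (integrable_re_eval _ p).ofReal
      have hq' : Integrable (fun ζ : Circle => ((q.eval (ζ : ℂ)).re : ℂ)) circleMeasure :=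
        (integrable_re_eval _ q).ofReal
      rw [schwarzIntegral, schwarzIntegral, schwarzIntegral, ← integral_add
        (integrable_mul_herglotzKernel hp' hξ) (integrable_mul_herglotzKernel hq' hξ)]
      congr 1
      funext ζ
      simp only [Polynomial.eval_add, Complex.add_re, Complex.ofReal_add]
      ring
    rw [h, hp, hq]
    simp only [Polynomial.eval_add, Complex.add_im, Complex.ofReal_add]
    ring
  | monomial n c =>
    have hint := integrable_re_eval circleMeasure (Polynomial.monomial n c)
    have hcoef : ∀ k : ℤ, ∀ j : ℕ, ∀ ζ : Circle,
        (ζ : ℂ) ^ k * conj (ζ : ℂ) ^ j = (ζ : ℂ) ^ (k - j) := by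
      intro k j ζ
      rw [conj_coe_circle, zpow_sub₀ (Circle.coe_ne_zero ζ), zpow_natCast, inv_pow, div_eq_mul_inv]
    have hI : ∀ k : ℤ, Integrable (fun ζ : Circle => (ζ : ℂ) ^ k) circleMeasure := fun k =>
      integrable_of_continuous
        (continuous_subtype_val.zpow₀ k fun ζ => Or.inl (Circle.coe_ne_zero ζ))
    -- The real part of `c ζ^n` has only the frequencies `n` and `-n`; the second contributes only
    -- when `n = j = 0`, where the two merge into `Re c`. This is how the imaginary part at `0` is
    -- lost.
    have hj : ∀ j : ℕ, ∫ ζ : Circle, ((((Polynomial.monomial n c).eval (ζ : ℂ)).re : ℝ) : ℂ) *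
        conj (ζ : ℂ) ^ j ∂circleMeasure =
          c / 2 * (if (n : ℤ) - j = 0 then 1 else 0)
            + conj c / 2 * (if -(n : ℤ) - j = 0 then 1 else 0) := by
      intro j
      rw [← integral_zpow_circleMeasure, ← integral_zpow_circleMeasure, ← integral_const_mul,
        ← integral_const_mul, ← integral_add ((hI _).const_mul _) ((hI _).const_mul _)]
      congr 1
      funext ζ
      rw [← hcoef, ← hcoef, Complex.re_eq_add_conj, Polynomial.eval_monomial, map_mul, map_pow,
        zpow_neg, zpow_natCast, conj_coe_circle, inv_pow]
      ring
    have h0 := hj 0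
    simp only [pow_zero, mul_one] at h0
    rw [schwarzIntegral_eq_tsum hint hξ, h0]
    simp_rw [hj]
    rw [tsum_eq_single n]
    · rcases Nat.eq_zero_or_pos n with rfl | hn
      · simp only [pow_zero, Nat.cast_zero, sub_zero, neg_zero, if_true, Polynomial.eval_monomial]
        apply Complex.ext <;> simp <;> ring
      · have h2 : -(n : ℤ) - n ≠ 0 := by omega
        have h4 : n ≠ 0 := by omega
        simp [h2, h4]
        ring
    · intro j hjn
      have h1 : (n : ℤ) - j ≠ 0 := by omega
      have h2 : -(n : ℤ) - j ≠ 0 := by omega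
      simp [h1, h2]

lemma exists_trigPoly_of_mem_span {T : ℝ} {F : C(AddCircle T, ℂ)}
    (hF : F ∈ Submodule.span ℂ (Set.range (@fourier T))) :
    ∃ q₁ q₂ : ℂ[X], ∀ t, F t = q₁.eval (AddCircle.toCircle t : ℂ) +
      conj (q₂.eval (AddCircle.toCircle t : ℂ)) := by
  induction hF using Submodule.span_induction with
  | mem x hx =>
    obtain ⟨n, rfl⟩ := hx
    rcases Int.le_total 0 n with hn | hn
    · lift n to ℕ using hn
      exact ⟨Polynomial.X ^ n, 0, fun t => by simp [fourier_apply, AddCircle.toCircle_nsmul]⟩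
    · obtain ⟨m, rfl⟩ : ∃ m : ℕ, n = -(m : ℤ) := ⟨n.natAbs, by omega⟩
      exact ⟨0, Polynomial.X ^ m, fun t => by
        rw [fourier_neg]; simp [fourier_apply, AddCircle.toCircle_nsmul]⟩
  | zero => exact ⟨0, 0, fun t => by simp⟩
  | add x y _ _ hx hy =>
    obtain ⟨p₁, p₂, hp⟩ := hx
    obtain ⟨q₁, q₂, hq⟩ := hy
    refine ⟨p₁ + q₁, p₂ + q₂, fun t => ?_⟩
    simp only [ContinuousMap.add_apply, hp, hq, Polynomial.eval_add, map_add]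
    ring
  | smul a x _ hx =>
    obtain ⟨p₁, p₂, hp⟩ := hx
    refine ⟨Polynomial.C a * p₁, Polynomial.C (conj a) * p₂, fun t => ?_⟩
    simp only [ContinuousMap.smul_apply, hp, Polynomial.eval_mul, Polynomial.eval_C, map_mul,
      Complex.conj_conj, smul_eq_mul]
    ring

/-- Real parts of polynomials are uniformly dense in the real continuous functions on the
circle. -/
lemma exists_re_eval_sub_lt {f : Circle → ℝ} (hf : Continuous f) {ε : ℝ} (hε : 0 < ε) :
    ∃ q : ℂ[X], ∀ ζ : Circle, |(q.eval (ζ : ℂ)).re - f ζ| < ε := by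
  have : Fact ((0 : ℝ) < 1) := ⟨one_pos⟩
  let e := AddCircle.homeomorphCircle (one_ne_zero (α := ℝ))
  let F : C(AddCircle (1 : ℝ), ℂ) := ⟨fun t => (f (e t) : ℂ), by fun_prop⟩
  have hF : F ∈ (Submodule.span ℂ (Set.range (@fourier (1 : ℝ)))).topologicalClosure := by
    rw [span_fourier_closure_eq_top]; trivial
  rw [← SetLike.mem_coe, Submodule.topologicalClosure_coe, Metric.mem_closure_iff] at hF
  obtain ⟨G, hG, hd⟩ := hF ε hε
  obtain ⟨q₁, q₂, hq⟩ := exists_trigPoly_of_mem_span hG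
  -- `q₁ + conj q₂` and `q₁ + q₂` have the same real part, and `f` is real.
  refine ⟨q₁ + q₂, fun ζ => ?_⟩
  have h1 := (ContinuousMap.dist_apply_le_dist (f := F) (g := G) (e.symm ζ)).trans_lt hd
  rw [dist_comm, hq, dist_eq_norm, ← AddCircle.homeomorphCircle_apply (one_ne_zero (α := ℝ))] at h1
  have h2 : e (e.symm ζ) = ζ := e.apply_symm_apply ζ
  have h3 : F (e.symm ζ) = (f ζ : ℂ) := by simp only [F, ContinuousMap.coe_mk, h2]
  change ‖q₁.eval ((e (e.symm ζ) : Circle) : ℂ) + conj (q₂.eval ((e (e.symm ζ) : Circle) : ℂ))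
    - F (e.symm ζ)‖ < ε at h1
  rw [h2, h3] at h1
  refine lt_of_le_of_lt ?_ h1
  refine le_trans (le_of_eq ?_) (Complex.abs_re_le_norm _)
  simp

/-- A bounded measurable function on the circle is approximated in mean by uniformly bounded real
parts of polynomials. -/
lemma exists_re_eval_integral_le {ν : Measure Circle} [IsFiniteMeasure ν] {g : Circle → ℝ}
    (hg : Measurable g) {M : ℝ} (hM : ∀ ζ, |g ζ| ≤ M) {ε : ℝ} (hε : 0 < ε) :
    ∃ q : ℂ[X], (∀ ζ : Circle, |(q.eval (ζ : ℂ)).re| ≤ M + 1) ∧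
      ∫ ζ, |(q.eval (ζ : ℂ)).re - g ζ| ∂ν ≤ ε := by
  have hgi : Integrable g ν := Integrable.of_bound hg.aestronglyMeasurable M (ae_of_all _ hM)
  obtain ⟨f, hf, hfi⟩ := hgi.exists_boundedContinuous_integral_sub_le (half_pos hε)
  -- Clipping to `[-M, M]` is a contraction fixing the values of `g`, so it brings `f` no farther
  -- from `g`.
  set f' : Circle → ℝ := fun ζ => max (-M) (min M (f ζ)) with hf'
  have hfc : Continuous f' := by fun_prop
  have hM0 : 0 ≤ M := (abs_nonneg _).trans (hM 1)
  have hf'M : ∀ ζ, |f' ζ| ≤ M := fun ζ => by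
    rw [abs_le]
    exact ⟨le_max_left _ _, max_le (by linarith) (min_le_left _ _)⟩
  have hf'g : ∀ ζ, |f' ζ - g ζ| ≤ ‖g ζ - f ζ‖ := fun ζ => by
    have h1 : g ζ = max (-M) (min M (g ζ)) := by
      rw [min_eq_right (abs_le.mp (hM ζ)).2, max_eq_right (abs_le.mp (hM ζ)).1]
    conv_lhs => rw [h1]
    rw [Real.norm_eq_abs, abs_sub_comm (g ζ)]
    refine (abs_max_sub_max_le_max _ _ _ _).trans ?_
    rw [sub_self, abs_zero, max_eq_right (abs_nonneg _)]
    refine (abs_min_sub_min_le_max _ _ _ _).trans ?_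
    rw [sub_self, abs_zero, max_eq_right (abs_nonneg _)]
  -- The `1` yields the bound `M + 1`; the other term keeps the uniform error below `ε/2` in mean,
  -- its `+ 1` guarding against zero total mass.
  set δ := min 1 (ε / 2 / (ν.real Set.univ + 1)) with hδ
  have hν : 0 < ν.real Set.univ + 1 := by positivity
  have hδ0 : 0 < δ := lt_min one_pos (by positivity)
  obtain ⟨q, hq⟩ := exists_re_eval_sub_lt hfc hδ0
  refine ⟨q, fun ζ => ?_, ?_⟩
  · have h1 := (hq ζ).le.trans (min_le_left _ _)
    have h2 := hf'M ζ
    rw [abs_le] at *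
    constructor <;> linarith
  · have hb : Integrable (fun ζ => δ + ‖g ζ - f ζ‖) ν :=
      (integrable_const _).add (hgi.sub hfi).norm
    have hl : Integrable (fun ζ : Circle => |(q.eval (ζ : ℂ)).re - g ζ|) ν :=
      ((integrable_re_eval ν q).sub hgi).abs
    have hn : Integrable (fun ζ => ‖g ζ - f ζ‖) ν := (hgi.sub hfi).norm
    refine (integral_mono hl hb fun ζ => ?_).trans ?_
    · have h1 := abs_sub_le (q.eval (ζ : ℂ)).re (f' ζ) (g ζ)
      have h2 := (hq ζ).le
      have h3 := hf'g ζ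
      simp only
      linarith
    · rw [integral_add (integrable_const _) hn, integral_const, smul_eq_mul]
      have h1 : ν.real Set.univ * δ ≤ ε / 2 := by
        have h2 : δ ≤ ε / 2 / (ν.real Set.univ + 1) := min_le_right _ _
        rw [le_div_iff₀ hν] at h2
        nlinarith
      linarith

/-! ### Extending mean square bounds from polynomials to outer multiples. -/

section Transfer

variable {ν : Measure Circle} {C : ℝ} {a b z w : ℂ}

lemma tendsto_expPartialSum (x : ℂ) :
    Tendsto (fun N : ℕ => ∑ k ∈ Finset.range N, (k.factorial : ℂ)⁻¹ * x ^ k) atTop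
      (𝓝 (Complex.exp x)) := by
  rw [Complex.exp_eq_exp_ℂ]
  have := (NormedSpace.exp_series_hasSum_exp' (𝕂 := ℂ) x).tendsto_sum_nat
  simpa only [smul_eq_mul] using this

lemma norm_expPartialSum_le (x : ℂ) (N : ℕ) :
    ‖∑ k ∈ Finset.range N, (k.factorial : ℂ)⁻¹ * x ^ k‖ ≤ Real.exp ‖x‖ := by
  refine (norm_sum_le _ _).trans (le_trans (le_of_eq ?_)
    (Real.sum_le_exp_of_nonneg (norm_nonneg x) N))
  refine Finset.sum_congr rfl fun k _ => ?_
  simp [div_eq_inv_mul]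

/-- A mean square bound for a combination of two evaluations extends from polynomials to products
of a polynomial and the exponential of a polynomial. -/
lemma norm_sq_le_integral_mul_exp [IsFiniteMeasure ν]
    (H : ∀ p : ℂ[X], ‖a * p.eval z + b * p.eval w‖ ^ 2 ≤ C * ∫ ζ : Circle, ‖p.eval (ζ : ℂ)‖ ^ 2 ∂ν)
    (h q : ℂ[X]) :
    ‖a * (h.eval z * Complex.exp (q.eval z)) + b * (h.eval w * Complex.exp (q.eval w))‖ ^ 2 ≤
      C * ∫ ζ : Circle, ‖h.eval (ζ : ℂ) * Complex.exp (q.eval (ζ : ℂ))‖ ^ 2 ∂ν := by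
  -- Taylor polynomials of `exp`, composed with `q`, keep `h * e N` a polynomial; on the circle they
  -- are dominated by `exp ‖q‖`.
  set e : ℕ → ℂ[X] := fun N =>
    ∑ k ∈ Finset.range N, Polynomial.C ((k.factorial : ℂ)⁻¹) * q ^ k with he
  have hev : ∀ N x, (e N).eval x = ∑ k ∈ Finset.range N, (k.factorial : ℂ)⁻¹ * (q.eval x) ^ k := by
    intro N x
    simp [he, Polynomial.eval_finsetSum]
  have hlim : ∀ x, Tendsto (fun N => (h * e N).eval x) atTop
      (𝓝 (h.eval x * Complex.exp (q.eval x))) := by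
    intro x
    simp_rw [Polynomial.eval_mul, hev]
    exact (tendsto_expPartialSum _).const_mul _
  refine le_of_tendsto_of_tendsto' ((((hlim z).const_mul a).add ((hlim w).const_mul b)).norm.pow 2)
    (Tendsto.const_mul C ?_) (fun N => H (h * e N))
  refine tendsto_integral_of_dominated_convergence
    (fun ζ : Circle => (‖h.eval (ζ : ℂ)‖ * Real.exp ‖q.eval (ζ : ℂ)‖) ^ 2)
    (fun N => ((continuous_eval_circle _).norm.pow 2).aestronglyMeasurable) ?_
    (fun N => ae_of_all _ fun ζ => ?_) (ae_of_all _ fun ζ => (hlim _).norm.pow 2)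
  · exact integrable_of_continuous (((continuous_eval_circle h).norm.mul
      (Real.continuous_exp.comp (continuous_eval_circle q).norm)).pow 2)
  · rw [Real.norm_eq_abs, abs_of_nonneg (by positivity), Polynomial.eval_mul, norm_mul, hev]
    gcongr
    exact norm_expPartialSum_le _ _

lemma norm_sq_mul_exp_half (x y : ℂ) :
    ‖x * Complex.exp (y / 2)‖ ^ 2 = ‖x‖ ^ 2 * Real.exp y.re := by
  rw [norm_mul, mul_pow, Complex.norm_exp, ← Real.exp_nat_mul]
  congr 2
  simp
  ring

lemma norm_sq_outer_re_eval_le [IsFiniteMeasure ν] (hz : ‖z‖ < 1) (hw : ‖w‖ < 1)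
    (H : ∀ p : ℂ[X], ‖a * p.eval z + b * p.eval w‖ ^ 2 ≤ C * ∫ ζ : Circle, ‖p.eval (ζ : ℂ)‖ ^ 2 ∂ν)
    (h q : ℂ[X]) :
    ‖a * (h.eval z * outer (fun ζ => (q.eval (ζ : ℂ)).re) z) +
        b * (h.eval w * outer (fun ζ => (q.eval (ζ : ℂ)).re) w)‖ ^ 2 ≤
      C * ∫ ζ : Circle, ‖h.eval (ζ : ℂ)‖ ^ 2 * Real.exp (q.eval (ζ : ℂ)).re ∂ν := by
  have h1 := norm_sq_le_integral_mul_exp H h (Polynomial.C (1 / 2) * q)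
  have h2 : ∀ x, (Polynomial.C (1 / 2) * q).eval x = q.eval x / 2 := by
    intro x
    rw [Polynomial.eval_mul, Polynomial.eval_C]
    ring
  simp_rw [h2, norm_sq_mul_exp_half] at h1
  refine le_trans (le_of_eq ?_) h1
  -- The imaginary part of `q(0)` costs a unimodular factor that is the same at `z` and `w`, so it
  -- drops out of the modulus.
  set u : ℂ := Complex.exp (((-(q.eval 0).im / 2 : ℝ) : ℂ) * Complex.I) with hu
  have hun : ‖u‖ = 1 := Complex.norm_exp_ofReal_mul_I _
  have ho : ∀ ξ : ℂ, ‖ξ‖ < 1 → outer (fun ζ => (q.eval (ζ : ℂ)).re) ξ =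
      u * Complex.exp (q.eval ξ / 2) := by
    intro ξ hξ
    rw [outer, schwarzIntegral_re_eval q hξ, hu, ← Complex.exp_add]
    congr 1
    push_cast
    ring
  rw [ho z hz, ho w hw, show a * (h.eval z * (u * Complex.exp (q.eval z / 2))) +
    b * (h.eval w * (u * Complex.exp (q.eval w / 2))) = u * (a * (h.eval z *
      Complex.exp (q.eval z / 2)) + b * (h.eval w * Complex.exp (q.eval w / 2))) by ring,
    norm_mul, hun, one_mul]

lemma tendsto_outer {g : Circle → ℝ} {G : ℕ → Circle → ℝ} (hg : Integrable g circleMeasure)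
    (hG : ∀ k, Integrable (G k) circleMeasure)
    (hlim : Tendsto (fun k => ∫ ζ, |G k ζ - g ζ| ∂circleMeasure) atTop (𝓝 0)) {ξ : ℂ}
    (hξ : ‖ξ‖ < 1) : Tendsto (fun k => outer (G k) ξ) atTop (𝓝 (outer g ξ)) := by
  have h : Tendsto (fun k => schwarzIntegral (G k) ξ) atTop (𝓝 (schwarzIntegral g ξ)) := by
    rw [tendsto_iff_norm_sub_tendsto_zero]
    refine squeeze_zero (fun _ => norm_nonneg _)
      (fun k => norm_schwarzIntegral_sub_le (hG k) hg hξ) ?_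
    simpa using hlim.const_mul (2 / (1 - ‖ξ‖))
  exact (Complex.continuous_exp.tendsto _).comp (h.div_const 2)

/-- The limit passage is made twice: from real parts of polynomials to bounded `g`, then from
bounded to integrable `g`. -/
lemma norm_sq_outer_le_of_tendsto (hz : ‖z‖ < 1) (hw : ‖w‖ < 1) {h : ℂ[X]} {g : Circle → ℝ}
    {G : ℕ → Circle → ℝ} (hg : Integrable g circleMeasure)
    (hG : ∀ k, Integrable (G k) circleMeasure)
    (hlim : Tendsto (fun k => ∫ ζ, |G k ζ - g ζ| ∂circleMeasure) atTop (𝓝 0))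
    (hν : Tendsto (fun k => ∫ ζ : Circle, ‖h.eval (ζ : ℂ)‖ ^ 2 * Real.exp (G k ζ) ∂ν) atTop
      (𝓝 (∫ ζ : Circle, ‖h.eval (ζ : ℂ)‖ ^ 2 * Real.exp (g ζ) ∂ν)))
    (H : ∀ k, ‖a * (h.eval z * outer (G k) z) + b * (h.eval w * outer (G k) w)‖ ^ 2 ≤
      C * ∫ ζ : Circle, ‖h.eval (ζ : ℂ)‖ ^ 2 * Real.exp (G k ζ) ∂ν) :
    ‖a * (h.eval z * outer g z) + b * (h.eval w * outer g w)‖ ^ 2 ≤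
      C * ∫ ζ : Circle, ‖h.eval (ζ : ℂ)‖ ^ 2 * Real.exp (g ζ) ∂ν :=
  le_of_tendsto_of_tendsto'
    (((((tendsto_outer hg hG hlim hz).const_mul _).const_mul a).add
      (((tendsto_outer hg hG hlim hw).const_mul _).const_mul b)).norm.pow 2)
    (hν.const_mul C) H

lemma abs_exp_sub_exp_le_of_le {x y M : ℝ} (hx : x ≤ M) (hy : y ≤ M) :
    |Real.exp x - Real.exp y| ≤ Real.exp M * |x - y| := by
  wlog hxy : y ≤ x generalizing x y
  · rw [abs_sub_comm, abs_sub_comm x]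
    exact this hy hx (le_of_not_ge hxy)
  rw [abs_of_nonneg (sub_nonneg.mpr (Real.exp_le_exp.mpr hxy)), abs_of_nonneg (sub_nonneg.mpr hxy)]
  have h1 : Real.exp x - Real.exp y = Real.exp x * (1 - Real.exp (y - x)) := by
    rw [mul_sub, ← Real.exp_add]
    ring_nf
  have h2 : 1 - Real.exp (y - x) ≤ x - y := by
    have := Real.add_one_le_exp (y - x)
    linarith
  rw [h1]
  exact mul_le_mul (Real.exp_le_exp.mpr hx) h2
    (sub_nonneg.mpr (Real.exp_le_one_iff.mpr (by linarith))) (Real.exp_pos _).le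

lemma exists_norm_sq_eval_circle_le (h : ℂ[X]) :
    ∃ B : ℝ, 0 ≤ B ∧ ∀ ζ : Circle, ‖h.eval (ζ : ℂ)‖ ^ 2 ≤ B := by
  obtain ⟨B, hB⟩ := isCompact_univ.exists_bound_of_continuousOn (α := Circle)
    ((continuous_eval_circle h).norm.pow 2).continuousOn
  refine ⟨B, (norm_nonneg _).trans (hB 1 trivial), fun ζ => (le_abs_self _).trans ?_⟩
  exact hB ζ trivial

lemma norm_sq_outer_le_of_bounded [IsFiniteMeasure ν] (hz : ‖z‖ < 1) (hw : ‖w‖ < 1)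
    (H : ∀ p : ℂ[X], ‖a * p.eval z + b * p.eval w‖ ^ 2 ≤ C * ∫ ζ : Circle, ‖p.eval (ζ : ℂ)‖ ^ 2 ∂ν)
    (h : ℂ[X]) {g : Circle → ℝ} (hg : Measurable g) {M : ℝ} (hM : ∀ ζ, |g ζ| ≤ M) :
    ‖a * (h.eval z * outer g z) + b * (h.eval w * outer g w)‖ ^ 2 ≤
      C * ∫ ζ : Circle, ‖h.eval (ζ : ℂ)‖ ^ 2 * Real.exp (g ζ) ∂ν := by
  -- Approximating in the sum of the two measures lets one sequence serve both sides: arc length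
  -- controls the outer functions, `ν` the integral.
  choose q hqM hq using fun k : ℕ => exists_re_eval_integral_le (ν := circleMeasure + ν) hg hM
    (ε := 1 / ((k : ℝ) + 1)) (by positivity)
  have hgi : ∀ (η : Measure Circle) [IsFiniteMeasure η], Integrable g η := fun η _ =>
    Integrable.of_bound hg.aestronglyMeasurable M (ae_of_all _ hM)
  have hdi : ∀ (η : Measure Circle) [IsFiniteMeasure η] (k : ℕ),
      Integrable (fun ζ : Circle => |((q k).eval (ζ : ℂ)).re - g ζ|) η := fun η _ k =>
    ((integrable_re_eval η (q k)).sub (hgi η)).abs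
  have hsplit : ∀ k, ∫ ζ : Circle, |((q k).eval (ζ : ℂ)).re - g ζ| ∂circleMeasure +
      ∫ ζ : Circle, |((q k).eval (ζ : ℂ)).re - g ζ| ∂ν ≤ 1 / ((k : ℝ) + 1) := fun k => by
    rw [← integral_add_measure (hdi _ k) (hdi _ k)]
    exact hq k
  have hnn : ∀ (η : Measure Circle) (k : ℕ),
      0 ≤ ∫ ζ : Circle, |((q k).eval (ζ : ℂ)).re - g ζ| ∂η :=
    fun η k => integral_nonneg fun ζ => abs_nonneg _
  obtain ⟨B, hB0, hB⟩ := exists_norm_sq_eval_circle_le h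
  refine norm_sq_outer_le_of_tendsto (G := fun k ζ => ((q k).eval (ζ : ℂ)).re) hz hw (hgi _)
    (fun k => integrable_re_eval _ (q k)) ?_ ?_
    (fun k => norm_sq_outer_re_eval_le hz hw H h (q k))
  · exact squeeze_zero (hnn _) (fun k => by linarith [hsplit k, hnn ν k])
      tendsto_one_div_add_atTop_nhds_zero_nat
  · rw [tendsto_iff_norm_sub_tendsto_zero]
    have hlim : Tendsto (fun k : ℕ => B * Real.exp (M + 1) * (1 / ((k : ℝ) + 1))) atTop (𝓝 0) := by
      simpa using tendsto_one_div_add_atTop_nhds_zero_nat.const_mul (B * Real.exp (M + 1))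
    refine squeeze_zero (fun _ => norm_nonneg _) (fun k => ?_) hlim
    have hi : ∀ f : Circle → ℝ, Measurable f → (∀ ζ, f ζ ≤ M + 1) →
        Integrable (fun ζ : Circle => ‖h.eval (ζ : ℂ)‖ ^ 2 * Real.exp (f ζ)) ν := by
      intro f hf hfM
      refine Integrable.of_bound (C := B * Real.exp (M + 1))
        (((continuous_eval_circle h).measurable.norm.pow_const 2).mul
          hf.exp).aestronglyMeasurable (ae_of_all _ fun ζ => ?_)
      rw [Real.norm_eq_abs, abs_of_nonneg (by positivity)]
      exact mul_le_mul (hB ζ) (Real.exp_le_exp.mpr (hfM ζ)) (Real.exp_pos _).le hB0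
    have hgM : ∀ ζ, g ζ ≤ M + 1 := fun ζ => by linarith [(abs_le.mp (hM ζ)).2]
    rw [← integral_sub (hi (fun ζ => ((q k).eval (ζ : ℂ)).re)
      (Complex.measurable_re.comp (continuous_eval_circle _).measurable)
      fun ζ => (abs_le.mp (hqM k ζ)).2) (hi g hg hgM)]
    calc ‖∫ ζ : Circle, (‖h.eval (ζ : ℂ)‖ ^ 2 * Real.exp ((q k).eval (ζ : ℂ)).re -
          ‖h.eval (ζ : ℂ)‖ ^ 2 * Real.exp (g ζ)) ∂ν‖
        ≤ ∫ ζ : Circle, B * Real.exp (M + 1) * |((q k).eval (ζ : ℂ)).re - g ζ| ∂ν := by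
          refine norm_integral_le_of_norm_le ((hdi ν k).const_mul _) (ae_of_all _ fun ζ => ?_)
          rw [← mul_sub, norm_mul, Real.norm_eq_abs, abs_of_nonneg (by positivity), mul_assoc]
          exact mul_le_mul (hB ζ)
            (abs_exp_sub_exp_le_of_le (abs_le.mp (hqM k ζ)).2 (hgM ζ)) (norm_nonneg _) hB0
      _ ≤ B * Real.exp (M + 1) * (1 / ((k : ℝ) + 1)) := by
          rw [integral_const_mul]
          refine mul_le_mul_of_nonneg_left ?_ (by positivity)
          linarith [hsplit k, hnn circleMeasure k]

/-- A mean square bound for a combination of two evaluations at points of the disk, valid for all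
polynomials, extends to the products of a polynomial and an outer function. -/
theorem norm_sq_outer_le [IsFiniteMeasure ν] (hz : ‖z‖ < 1) (hw : ‖w‖ < 1)
    (H : ∀ p : ℂ[X], ‖a * p.eval z + b * p.eval w‖ ^ 2 ≤ C * ∫ ζ : Circle, ‖p.eval (ζ : ℂ)‖ ^ 2 ∂ν)
    (h : ℂ[X]) {g : Circle → ℝ} (hg : Measurable g) (hgi : Integrable g circleMeasure)
    (hge : Integrable (fun ζ => Real.exp (g ζ)) ν) :
    ‖a * (h.eval z * outer g z) + b * (h.eval w * outer g w)‖ ^ 2 ≤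
      C * ∫ ζ : Circle, ‖h.eval (ζ : ℂ)‖ ^ 2 * Real.exp (g ζ) ∂ν := by
  -- Truncations at `±k` agree with `g` at each point for large `k`. Dominating functions are `|g|`
  -- for the outer values and a multiple of `1 + exp g` for the integrals.
  set G : ℕ → Circle → ℝ := fun k ζ => max (-(k : ℝ)) (min k (g ζ)) with hG
  have hGm : ∀ k, Measurable (G k) := fun k =>
    measurable_const.max (measurable_const.min hg)
  have hGk : ∀ k ζ, |G k ζ| ≤ k := fun k ζ => by
    have : (0 : ℝ) ≤ k := k.cast_nonneg
    rw [abs_le]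
    exact ⟨le_max_left _ _, max_le (by linarith) (min_le_left _ _)⟩
  have hGi : ∀ k, Integrable (G k) circleMeasure := fun k =>
    Integrable.of_bound (hGm k).aestronglyMeasurable k (ae_of_all _ (hGk k))
  have hGle : ∀ k ζ, |G k ζ - g ζ| ≤ |g ζ| := by
    intro k ζ
    have hk : (0 : ℝ) ≤ k := k.cast_nonneg
    simp only [hG]
    rcases le_total (k : ℝ) (g ζ) with h1 | h1
    · rw [min_eq_left h1, max_eq_right (by linarith), abs_of_nonpos (by linarith),
        abs_of_nonneg (by linarith)]
      linarith
    · rw [min_eq_right h1]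
      rcases le_total (-(k : ℝ)) (g ζ) with h2 | h2
      · rw [max_eq_right h2, sub_self, abs_zero]
        exact abs_nonneg _
      · rw [max_eq_left h2, abs_of_nonneg (by linarith), abs_of_nonpos (by linarith)]
        linarith
  have hGt : ∀ ζ, ∀ᶠ k : ℕ in atTop, G k ζ = g ζ := by
    intro ζ
    obtain ⟨N, hN⟩ := exists_nat_ge |g ζ|
    filter_upwards [eventually_ge_atTop N] with k hk
    have h1 : |g ζ| ≤ k := hN.trans (by exact_mod_cast hk)
    simp only [hG]
    rw [min_eq_right (abs_le.mp h1).2, max_eq_right (abs_le.mp h1).1]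
  obtain ⟨B, hB0, hB⟩ := exists_norm_sq_eval_circle_le h
  refine norm_sq_outer_le_of_tendsto hz hw hgi hGi ?_ ?_
    (fun k => norm_sq_outer_le_of_bounded hz hw H h (hGm k) (hGk k))
  · have h0 : (0 : ℝ) = ∫ _ζ : Circle, (0 : ℝ) ∂circleMeasure := by simp
    rw [h0]
    refine tendsto_integral_of_dominated_convergence (fun ζ => |g ζ|)
      (fun k => ((hGm k).sub hg).abs.aestronglyMeasurable) hgi.abs
      (fun k => ae_of_all _ fun ζ => ?_) (ae_of_all _ fun ζ => ?_)
    · rw [Real.norm_eq_abs, abs_abs]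
      exact hGle k ζ
    · refine tendsto_const_nhds.congr' ?_
      filter_upwards [hGt ζ] with k hk
      rw [hk, sub_self, abs_zero]
  · refine tendsto_integral_of_dominated_convergence (fun ζ => B * (1 + Real.exp (g ζ)))
      (fun k => (((continuous_eval_circle h).measurable.norm.pow_const 2).mul
        (hGm k).exp).aestronglyMeasurable) (((integrable_const 1).add hge).const_mul B)
      (fun k => ae_of_all _ fun ζ => ?_) (ae_of_all _ fun ζ => ?_)
    · rw [Real.norm_eq_abs, abs_of_nonneg (by positivity)]
      refine mul_le_mul (hB ζ) ?_ (Real.exp_pos _).le hB0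
      have h1 : G k ζ ≤ max 0 (g ζ) :=
        max_le ((neg_nonpos.mpr k.cast_nonneg).trans (le_max_left _ _))
          ((min_le_right _ _).trans (le_max_right _ _))
      refine (Real.exp_le_exp.mpr h1).trans ?_
      rcases le_total 0 (g ζ) with h2 | h2
      · rw [max_eq_right h2]; linarith
      · rw [max_eq_left h2, Real.exp_zero]; linarith [Real.exp_pos (g ζ)]
    · refine tendsto_const_nhds.congr' ?_
      filter_upwards [hGt ζ] with k hk
      rw [hk]

end Transfer

/-! ### Norms of functionals as square sums along orthonormal polynomials. -/

section Orthonormal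

variable {ν : Measure Circle} {φ : ℕ → ℂ[X]} {C : ℝ}

lemma IsOrthonormal.exists_eq_sum (hφ : IsOrthonormal ν φ) (n : ℕ) :
    ∀ p : ℂ[X], p.degree < n → ∃ c : ℕ → ℂ, p = ∑ j ∈ Finset.range n, c j • φ j := by
  induction n with
  | zero =>
    intro p hp
    refine ⟨0, ?_⟩
    rw [Finset.range_zero, Finset.sum_empty, ← Polynomial.degree_eq_bot]
    simpa [Nat.WithBot.lt_zero_iff] using hp
  | succ n ih =>
    intro p hp
    have hne : (φ n).coeff n ≠ 0 := by
      have hdeg := Polynomial.natDegree_eq_of_degree_eq_some (hφ.degree_eq n)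
      have hlead : (φ n).coeff n = (φ n).leadingCoeff := by rw [Polynomial.leadingCoeff, hdeg]
      rw [hlead, Polynomial.leadingCoeff_ne_zero]
      intro h0
      have := hφ.degree_eq n
      rw [h0, Polynomial.degree_zero] at this
      exact absurd this (by simp)
    have hq : (p - (p.coeff n / (φ n).coeff n) • φ n).degree < n := by
      rw [Polynomial.degree_lt_iff_coeff_zero]
      intro m hm
      rcases hm.eq_or_lt with rfl | hm
      · simp [hne]
      · have h1 : p.coeff m = 0 := Polynomial.coeff_eq_zero_of_degree_lt
          (hp.trans_le (by exact_mod_cast hm))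
        have h2 : (φ n).coeff m = 0 := Polynomial.coeff_eq_zero_of_degree_lt
          (by rw [hφ.degree_eq]; exact_mod_cast hm)
        simp [h1, h2]
    obtain ⟨c, hc⟩ := ih _ hq
    refine ⟨fun j => if j = n then p.coeff n / (φ n).coeff n else c j, ?_⟩
    simp only [Finset.sum_range_succ, if_true]
    rw [← sub_eq_iff_eq_add, hc]
    refine Finset.sum_congr rfl fun j hj => ?_
    rw [if_neg (Finset.mem_range.mp hj).ne]

lemma IsOrthonormal.integral_norm_sq_sum [IsFiniteMeasure ν] (hφ : IsOrthonormal ν φ) (n : ℕ)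
    (c : ℕ → ℂ) :
    ∫ ζ : Circle, ‖(∑ j ∈ Finset.range n, c j • φ j).eval (ζ : ℂ)‖ ^ 2 ∂ν =
      ∑ j ∈ Finset.range n, ‖c j‖ ^ 2 := by
  have hint : ∀ j k, Integrable (fun ζ : Circle =>
      c j * conj (c k) * ((φ j).eval (ζ : ℂ) * conj ((φ k).eval (ζ : ℂ)))) ν := fun j k =>
    integrable_of_continuous (continuous_const.mul ((continuous_eval_circle _).mul
      (Complex.continuous_conj.comp (continuous_eval_circle _))))
  have hexp : ∀ ζ : Circle,
      ((‖(∑ j ∈ Finset.range n, c j • φ j).eval (ζ : ℂ)‖ ^ 2 : ℝ) : ℂ) =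
        ∑ j ∈ Finset.range n, ∑ k ∈ Finset.range n,
          c j * conj (c k) * ((φ j).eval (ζ : ℂ) * conj ((φ k).eval (ζ : ℂ))) := by
    intro ζ
    push_cast
    rw [← Complex.mul_conj', Polynomial.eval_finsetSum, map_sum, Finset.sum_mul_sum]
    refine Finset.sum_congr rfl fun j _ => Finset.sum_congr rfl fun k _ => ?_
    simp only [Polynomial.eval_smul, smul_eq_mul, map_mul]
    ring
  apply Complex.ofReal_injective
  rw [← integral_complex_ofReal]
  simp_rw [hexp]
  rw [integral_finsetSum _ fun j _ => integrable_finsetSum _ fun k _ => hint j k]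
  push_cast
  refine Finset.sum_congr rfl fun j hj => ?_
  rw [integral_finsetSum _ fun k _ => hint j k]
  simp_rw [integral_const_mul, hφ.orthonormal]
  simp only [mul_ite, mul_one, mul_zero, Finset.sum_ite_eq, if_pos hj]
  exact Complex.mul_conj' _

lemma IsOrthonormal.sum_norm_sq_le [IsFiniteMeasure ν] (hφ : IsOrthonormal ν φ)
    (Λ : ℂ[X] →ₗ[ℂ] ℂ)
    (H : ∀ p : ℂ[X], ‖Λ p‖ ^ 2 ≤ C * ∫ ζ : Circle, ‖p.eval (ζ : ℂ)‖ ^ 2 ∂ν) (n : ℕ) :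
    ∑ j ∈ Finset.range n, ‖Λ (φ j)‖ ^ 2 ≤ C := by
  -- This is the extremal test polynomial: for the square sum `S` it gives `S² ≤ C * S`.
  have h := H (∑ j ∈ Finset.range n, conj (Λ (φ j)) • φ j)
  rw [hφ.integral_norm_sq_sum, map_sum] at h
  have h1 : ∑ j ∈ Finset.range n, Λ (conj (Λ (φ j)) • φ j) =
      ((∑ j ∈ Finset.range n, ‖Λ (φ j)‖ ^ 2 : ℝ) : ℂ) := by
    push_cast
    refine Finset.sum_congr rfl fun j _ => ?_
    rw [map_smul, smul_eq_mul, Complex.conj_mul']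
  simp_rw [RCLike.norm_conj] at h
  rw [h1, Complex.norm_real, Real.norm_eq_abs, sq_abs] at h
  set S := ∑ j ∈ Finset.range n, ‖Λ (φ j)‖ ^ 2 with hS
  have hS0 : 0 ≤ S := Finset.sum_nonneg fun j _ => by positivity
  rcases hS0.eq_or_lt with h0 | h0
  -- When `S = 0` division is impossible, and `0 ≤ C` comes from testing on `φ 0`, which has norm
  -- one.
  · have h2 := H (φ 0)
    have h3 : ∫ ζ : Circle, ‖(φ 0).eval (ζ : ℂ)‖ ^ 2 ∂ν = 1 := by
      have := hφ.integral_norm_sq_sum 1 1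
      simpa using this
    rw [h3, mul_one] at h2
    rw [← h0]
    exact (by positivity : (0 : ℝ) ≤ ‖Λ (φ 0)‖ ^ 2).trans h2
  · exact le_of_mul_le_mul_right (by rwa [← sq]) h0

/-- By Cauchy–Schwarz on the coefficients of `p`; with `sum_norm_sq_le` this makes the two kinds of
bound equivalent. -/
lemma IsOrthonormal.norm_sq_le_integral [IsFiniteMeasure ν] (hφ : IsOrthonormal ν φ)
    (Λ : ℂ[X] →ₗ[ℂ] ℂ) (H : ∀ n, ∑ j ∈ Finset.range n, ‖Λ (φ j)‖ ^ 2 ≤ C) (p : ℂ[X]) :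
    ‖Λ p‖ ^ 2 ≤ C * ∫ ζ : Circle, ‖p.eval (ζ : ℂ)‖ ^ 2 ∂ν := by
  obtain ⟨c, hc⟩ := hφ.exists_eq_sum (p.natDegree + 1) p
    (p.degree_le_natDegree.trans_lt (by exact_mod_cast Nat.lt_succ_self _))
  set n := p.natDegree + 1
  rw [hc, hφ.integral_norm_sq_sum, map_sum]
  have h1 : ‖∑ j ∈ Finset.range n, Λ (c j • φ j)‖ ≤ ∑ j ∈ Finset.range n, ‖Λ (φ j)‖ * ‖c j‖ := by
    refine (norm_sum_le _ _).trans (le_of_eq (Finset.sum_congr rfl fun j _ => ?_))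
    rw [map_smul, norm_smul, mul_comm]
  calc ‖∑ j ∈ Finset.range n, Λ (c j • φ j)‖ ^ 2
      ≤ (∑ j ∈ Finset.range n, ‖Λ (φ j)‖ * ‖c j‖) ^ 2 := by gcongr
    _ ≤ (∑ j ∈ Finset.range n, ‖Λ (φ j)‖ ^ 2) * ∑ j ∈ Finset.range n, ‖c j‖ ^ 2 :=
        Finset.sum_mul_sq_le_sq_mul_sq _ _ _
    _ ≤ C * ∑ j ∈ Finset.range n, ‖c j‖ ^ 2 :=
        mul_le_mul_of_nonneg_right (H n) (Finset.sum_nonneg fun j _ => by positivity)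

end Orthonormal

/-! ### Comparing evaluation functionals for two measures. -/

/-- The functional `p ↦ a * p z + b * p w` on polynomials. -/
def evalCombination (a b z w : ℂ) : ℂ[X] →ₗ[ℂ] ℂ :=
  a • Polynomial.leval z + b • Polynomial.leval w

lemma evalCombination_apply (a b z w : ℂ) (p : ℂ[X]) :
    evalCombination a b z w p = a * p.eval z + b * p.eval w := by
  simp [evalCombination]

lemma outer_neg (g : Circle → ℝ) (ξ : ℂ) : outer (fun ζ => -g ζ) ξ = (outer g ξ)⁻¹ := by
  rw [outer, outer, ← Complex.exp_neg, schwarzIntegral, schwarzIntegral, ← neg_div, ← integral_neg]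
  simp_rw [Complex.ofReal_neg, neg_mul]

section Szego

variable {ν : Measure Circle} [IsFiniteMeasure ν] {φ ψ : ℕ → ℂ[X]} {C : ℝ}
  {a b z w : ℂ}

/-- Comparison of the square sums of an evaluation functional along two orthonormal systems whose
measures differ by the factor `exp g`. -/
lemma sum_norm_sq_outer_le {η : Measure Circle} [IsFiniteMeasure η] (hφ : IsOrthonormal ν φ)
    (hψ : IsOrthonormal η ψ) {g : Circle → ℝ} (hg : Measurable g)
    (hgi : Integrable g circleMeasure) (hge : Integrable (fun ζ => Real.exp (g ζ)) ν)
    (hη : ∀ p : ℂ[X], ∫ ζ : Circle, ‖p.eval (ζ : ℂ)‖ ^ 2 * Real.exp (g ζ) ∂ν =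
      ∫ ζ : Circle, ‖p.eval (ζ : ℂ)‖ ^ 2 ∂η)
    (hz : ‖z‖ < 1) (hw : ‖w‖ < 1)
    (H : ∀ n, ∑ j ∈ Finset.range n, ‖a * (φ j).eval z + b * (φ j).eval w‖ ^ 2 ≤ C) (n : ℕ) :
    ∑ j ∈ Finset.range n,
      ‖a * outer g z * (ψ j).eval z + b * outer g w * (ψ j).eval w‖ ^ 2 ≤ C := by
  -- Square sums along `φ` become a bound on polynomials, the outer factor moves it to `η`, and
  -- duality returns to square sums along `ψ`.
  have h1 := hφ.norm_sq_le_integral (evalCombination a b z w)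
    (by simpa only [evalCombination_apply] using H)
  simp only [evalCombination_apply] at h1
  have h2 := hψ.sum_norm_sq_le (C := C) (evalCombination (a * outer g z) (b * outer g w) z w)
    (fun p => by
      have h3 := norm_sq_outer_le hz hw h1 p hg hgi hge
      rw [hη] at h3
      rw [evalCombination_apply]
      convert h3 using 3
      ring) n
  simpa only [evalCombination_apply] using h2

end Szego

namespace IsSzegoDensity

variable {μ : Measure Circle} {ω : Circle → ℝ} {φ : ℕ → ℂ[X]} {C : ℝ} {a b z w : ℂ}

lemma isFiniteMeasure (h : IsSzegoDensity μ ω) : IsFiniteMeasure μ := by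
  rw [h.eq_withDensity]
  exact isFiniteMeasure_withDensity_ofReal h.integrable.2

lemma integral_eq (h : IsSzegoDensity μ ω) (f : Circle → ℝ) :
    ∫ ζ, f ζ ∂μ = ∫ ζ, ω ζ * f ζ ∂circleMeasure := by
  rw [h.eq_withDensity, integral_withDensity_eq_integral_toReal_smul h.measurable.ennreal_ofReal
    (ae_of_all _ fun _ => ENNReal.ofReal_lt_top)]
  simp only [ENNReal.toReal_ofReal (h.pos _).le, smul_eq_mul]

/-- Arc length to `μ`, with `g = log ω`. -/
lemma sum_norm_sq_le (h : IsSzegoDensity μ ω) (hφ : IsOrthonormal μ φ) (hz : ‖z‖ < 1)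
    (hw : ‖w‖ < 1) (H : ∀ n, ∑ j ∈ Finset.range n, ‖a * z ^ j + b * w ^ j‖ ^ 2 ≤ C) (n : ℕ) :
    ∑ j ∈ Finset.range n, ‖a * outer (fun ζ => Real.log (ω ζ)) z * (φ j).eval z +
      b * outer (fun ζ => Real.log (ω ζ)) w * (φ j).eval w‖ ^ 2 ≤ C := by
  have := h.isFiniteMeasure
  refine sum_norm_sq_outer_le isOrthonormal_X_pow hφ h.measurable.log h.log_integrable ?_ ?_ hz hw
    (by simpa using H) n
  · simp_rw [Real.exp_log (h.pos _)]
    exact h.integrable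
  · intro p
    simp_rw [Real.exp_log (h.pos _), h.integral_eq, mul_comm]

/-- The reverse passage, with `g = -log ω`: its outer function is `1/D`, and `ω⁻¹ dμ` is arc length.
-/
lemma sum_norm_sq_pow_le (h : IsSzegoDensity μ ω) (hφ : IsOrthonormal μ φ) (hz : ‖z‖ < 1)
    (hw : ‖w‖ < 1)
    (H : ∀ n, ∑ j ∈ Finset.range n, ‖a * outer (fun ζ => Real.log (ω ζ)) z * (φ j).eval z +
      b * outer (fun ζ => Real.log (ω ζ)) w * (φ j).eval w‖ ^ 2 ≤ C) (n : ℕ) :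
    ∑ j ∈ Finset.range n, ‖a * z ^ j + b * w ^ j‖ ^ 2 ≤ C := by
  have := h.isFiniteMeasure
  have hinv : ∀ ζ, Real.exp (-Real.log (ω ζ)) = (ω ζ)⁻¹ := fun ζ => by
    rw [Real.exp_neg, Real.exp_log (h.pos ζ)]
  have h1 := sum_norm_sq_outer_le hφ isOrthonormal_X_pow (g := fun ζ => -Real.log (ω ζ))
    h.measurable.log.neg h.log_integrable.neg ?_ ?_ hz hw H n
  · simp only [outer_neg, Polynomial.eval_pow, Polynomial.eval_X] at h1
    rwa [mul_assoc a, mul_assoc b, mul_inv_cancel₀ (outer_ne_zero _ _),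
      mul_inv_cancel₀ (outer_ne_zero _ _), mul_one, mul_one] at h1
  · simp_rw [hinv]
    rw [h.eq_withDensity, integrable_withDensity_iff h.measurable.ennreal_ofReal
      (ae_of_all _ fun _ => ENNReal.ofReal_lt_top)]
    simp_rw [ENNReal.toReal_ofReal (h.pos _).le, inv_mul_cancel₀ (h.pos _).ne']
    exact integrable_const _
  · intro p
    simp_rw [hinv, h.integral_eq]
    refine integral_congr_ae (ae_of_all _ fun ζ => ?_)
    have := (h.pos ζ).ne'
    simp only
    field_simp

end IsSzegoDensity

/-! ### Square summable sequences and evaluation vectors. -/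

/-- The Hilbert space of square summable complex sequences. -/
abbrev SqSummable : Type := lp (fun _ : ℕ => ℂ) 2

lemma memℓp_two_of_sum_le {u : ℕ → ℂ} {C : ℝ}
    (h : ∀ n, ∑ j ∈ Finset.range n, ‖u j‖ ^ 2 ≤ C) : Memℓp u 2 := by
  refine memℓp_gen ?_
  simp only [ENNReal.toReal_ofNat, Real.rpow_ofNat]
  exact summable_of_sum_range_le (fun _ => by positivity) h

lemma SqSummable.combination_apply (a b : ℂ) (f g : SqSummable) (j : ℕ) :
    (a • f + b • g) j = a * f j + b * g j := rfl

lemma SqSummable.smul_apply (a : ℂ) (f : SqSummable) (j : ℕ) : (a • f) j = a * f j := rfl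

lemma SqSummable.hasSum_norm_sq (f : SqSummable) : HasSum (fun j => ‖f j‖ ^ 2) (‖f‖ ^ 2) := by
  have := lp.hasSum_norm (p := 2) (by norm_num) f
  simpa only [ENNReal.toReal_ofNat, Real.rpow_ofNat] using this

lemma SqSummable.norm_sub_sum_single (f : SqSummable) (s : Finset ℕ) :
    ‖f - ∑ j ∈ s, lp.single 2 j (f j)‖ ^ 2 = ‖f‖ ^ 2 - ∑ j ∈ s, ‖f j‖ ^ 2 := by
  have := lp.norm_compl_sum_single (p := 2) (by norm_num) f s
  simpa only [ENNReal.toReal_ofNat, Real.rpow_ofNat] using this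

/-- Quantifying over `C` matches the comparison lemmas; it is applied with `C = ‖f‖²`. -/
lemma SqSummable.norm_le_of_sum_le {f g : SqSummable}
    (h : ∀ C : ℝ, (∀ n, ∑ j ∈ Finset.range n, ‖f j‖ ^ 2 ≤ C) →
      ∀ n, ∑ j ∈ Finset.range n, ‖g j‖ ^ 2 ≤ C) : ‖g‖ ≤ ‖f‖ := by
  have h1 : ∀ n, ∑ j ∈ Finset.range n, ‖f j‖ ^ 2 ≤ ‖f‖ ^ 2 := fun n =>
    sum_le_hasSum _ (fun _ _ => by positivity) f.hasSum_norm_sq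
  have h2 := le_of_tendsto' g.hasSum_norm_sq.tendsto_sum_nat (h _ h1)
  exact le_of_sq_le_sq h2 (norm_nonneg _)

/-- Two pairs of vectors with equal norms of all their linear combinations have equal inner
products. -/
lemma inner_eq_inner_of_norm_eq {E : Type*} [NormedAddCommGroup E] [InnerProductSpace ℂ E]
    {x y x' y' : E} (h : ∀ a b : ℂ, ‖a • x + b • y‖ = ‖a • x' + b • y'‖) :
    inner ℂ x y = inner ℂ x' y' := by
  rw [inner_eq_sum_norm_sq_div_four, inner_eq_sum_norm_sq_div_four]
  have h1 := h 1 1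
  have h2 := h 1 (-1)
  have h3 := h 1 Complex.I
  have h4 := h 1 (-Complex.I)
  simp only [one_smul, neg_smul, ← sub_eq_add_neg] at h1 h2 h3 h4
  simp only [RCLike.I_to_complex]
  rw [h1, h2, h3, h4]

section Evaluation

variable (φ : ℕ → ℂ[X])

open Classical in
/-- The sequence `(φ j (z))_j`, where it is square summable. -/
def evalSeq (z : ℂ) : SqSummable :=
  if h : Memℓp (fun j => (φ j).eval z) 2 then ⟨_, h⟩ else 0

/-- The sequence `(φ j (z))_j`, cut off after `j = n`. -/
def truncEvalSeq (n : ℕ) (z : ℂ) : SqSummable :=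
  ∑ j ∈ Finset.range (n + 1), (φ j).eval z • lp.single 2 j (1 : ℂ)

variable {φ}

lemma evalSeq_apply {z : ℂ} (h : Memℓp (fun j => (φ j).eval z) 2) (j : ℕ) :
    evalSeq φ z j = (φ j).eval z := by
  rw [evalSeq, dif_pos h]

lemma smul_single_one (j : ℕ) (c : ℂ) :
    c • (lp.single 2 j (1 : ℂ) : SqSummable) = lp.single 2 j c := by
  rw [← lp.single_smul, smul_eq_mul, mul_one]

/-- Pythagoras; it turns scalar convergence of `K_n(z,z)` into convergence of vectors. -/
lemma norm_sq_evalSeq_sub_truncEvalSeq {z : ℂ} (h : Memℓp (fun j => (φ j).eval z) 2) (n : ℕ) :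
    ‖evalSeq φ z - truncEvalSeq φ n z‖ ^ 2 =
      ‖evalSeq φ z‖ ^ 2 - ∑ j ∈ Finset.range (n + 1), ‖(φ j).eval z‖ ^ 2 := by
  have h1 := (evalSeq φ z).norm_sub_sum_single (Finset.range (n + 1))
  simp only [evalSeq_apply h] at h1
  rw [← h1, truncEvalSeq]
  simp only [smul_single_one]

lemma hasDerivAt_truncEvalSeq (n : ℕ) (z : ℂ) :
    HasDerivAt (truncEvalSeq φ n)
      (truncEvalSeq (fun j => Polynomial.derivative (φ j)) n z) z := by
  unfold truncEvalSeq
  exact HasDerivAt.fun_sum fun j _ => ((φ j).hasDerivAt z).smul_const _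

lemma inner_truncEvalSeq (ψ : ℕ → ℂ[X]) (n : ℕ) (z w : ℂ) :
    inner ℂ (truncEvalSeq ψ n w) (truncEvalSeq φ n z) =
      ∑ j ∈ Finset.range (n + 1), (φ j).eval z * conj ((ψ j).eval w) := by
  unfold truncEvalSeq
  rw [sum_inner]
  refine Finset.sum_congr rfl fun j hj => ?_
  rw [inner_sum, Finset.sum_eq_single j]
  · rw [smul_single_one, lp.inner_single_left]
    simp [mul_comm]
  · intro k _ hkj
    rw [smul_single_one, lp.inner_single_left]
    simp [hkj]
  · exact fun h => absurd hj h

end Evaluation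

/-! ### The limit kernel and locally uniform convergence. -/

namespace IsSzegoDensity

variable {μ : Measure Circle} {ω : Circle → ℝ} {φ : ℕ → ℂ[X]} {z w : ℂ}

lemma memℓp_pow (hz : ‖z‖ < 1) : Memℓp (fun j => ((Polynomial.X : ℂ[X]) ^ j).eval z) 2 := by
  refine memℓp_gen ?_
  simp only [ENNReal.toReal_ofNat, Real.rpow_ofNat, Polynomial.eval_pow, Polynomial.eval_X,
    norm_pow, ← pow_mul, mul_comm _ 2]
  simp only [pow_mul]
  exact summable_geometric_of_lt_one (by positivity) (by nlinarith [norm_nonneg z])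

lemma memℓp_eval (h : IsSzegoDensity μ ω) (hφ : IsOrthonormal μ φ) (hz : ‖z‖ < 1) :
    Memℓp (fun j => (φ j).eval z) 2 := by
  have hD := outer_ne_zero (fun ζ => Real.log (ω ζ)) z
  -- With `a = 1/D(z)` and `b = 0` the comparison bounds the square sum of `φ_j(z)` itself.
  have h1 := h.sum_norm_sq_le (a := (outer (fun ζ => Real.log (ω ζ)) z)⁻¹) (b := 0)
    (C := ‖(outer (fun ζ => Real.log (ω ζ)) z)⁻¹ • evalSeq (fun j => Polynomial.X ^ j) z‖ ^ 2)
    hφ hz hz fun n => by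
      have h2 := sum_le_hasSum (Finset.range n) (fun _ _ => by positivity)
        ((outer (fun ζ => Real.log (ω ζ)) z)⁻¹ •
          evalSeq (fun j => (Polynomial.X : ℂ[X]) ^ j) z).hasSum_norm_sq
      simpa [evalSeq_apply (memℓp_pow hz)] using h2
  refine memℓp_two_of_sum_le fun n => le_trans (le_of_eq ?_) (h1 n)
  simp [inv_mul_cancel₀ hD]

lemma inner_evalSeq_pow (hz : ‖z‖ < 1) (hw : ‖w‖ < 1) :
    inner ℂ (evalSeq (fun j => (Polynomial.X : ℂ[X]) ^ j) w)
      (evalSeq (fun j => (Polynomial.X : ℂ[X]) ^ j) z) = (1 - z * conj w)⁻¹ := by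
  rw [lp.inner_eq_tsum, ← tsum_geometric_of_norm_lt_one]
  · congr 1
    funext j
    rw [evalSeq_apply (memℓp_pow hw), evalSeq_apply (memℓp_pow hz)]
    simp [mul_pow]
  · rw [norm_mul, RCLike.norm_conj]
    nlinarith [norm_nonneg z, norm_nonneg w]

/-- The limit of the reproducing kernels of a measure in the Szegő class. -/
theorem inner_evalSeq (h : IsSzegoDensity μ ω) (hφ : IsOrthonormal μ φ) (hz : ‖z‖ < 1)
    (hw : ‖w‖ < 1) :
    inner ℂ (evalSeq φ w) (evalSeq φ z) =
      ((1 - z * conj w) * outer (fun ζ => Real.log (ω ζ)) z *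
        conj (outer (fun ζ => Real.log (ω ζ)) w))⁻¹ := by
  set D := outer (fun ζ => Real.log (ω ζ)) with hD
  have hDz : D z ≠ 0 := outer_ne_zero _ _
  have hDw : conj (D w) ≠ 0 := (map_ne_zero _).mpr (outer_ne_zero _ _)
  have key : inner ℂ (D w • evalSeq φ w) (D z • evalSeq φ z) = (1 - z * conj w)⁻¹ := by
    rw [← inner_evalSeq_pow hz hw]
    -- The two inequalities are the two directions of the comparison between `μ` and arc length.
    refine inner_eq_inner_of_norm_eq fun a b => le_antisymm ?_ ?_
    · refine SqSummable.norm_le_of_sum_le fun C hC n => ?_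
      simp only [SqSummable.combination_apply, SqSummable.smul_apply, ← mul_assoc,
        evalSeq_apply (h.memℓp_eval hφ hw), evalSeq_apply (h.memℓp_eval hφ hz)]
      refine h.sum_norm_sq_le hφ hw hz ?_ n
      simpa only [SqSummable.combination_apply, evalSeq_apply (memℓp_pow hw),
        evalSeq_apply (memℓp_pow hz), Polynomial.eval_pow, Polynomial.eval_X] using hC
    · refine SqSummable.norm_le_of_sum_le fun C hC n => ?_
      simp only [SqSummable.combination_apply, evalSeq_apply (memℓp_pow hw),
        evalSeq_apply (memℓp_pow hz), Polynomial.eval_pow, Polynomial.eval_X]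
      refine h.sum_norm_sq_pow_le hφ hw hz ?_ n
      simpa only [SqSummable.combination_apply, SqSummable.smul_apply, ← mul_assoc,
        evalSeq_apply (h.memℓp_eval hφ hw), evalSeq_apply (h.memℓp_eval hφ hz)] using hC
  rw [inner_smul_left, inner_smul_right] at key
  rw [mul_assoc, mul_inv, ← key]
  field_simp

lemma norm_sq_evalSeq (h : IsSzegoDensity μ ω) (hφ : IsOrthonormal μ φ) (hz : ‖z‖ < 1) :
    ‖evalSeq φ z‖ ^ 2 = ((1 - ‖z‖ ^ 2) * ‖outer (fun ζ => Real.log (ω ζ)) z‖ ^ 2)⁻¹ := by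
  have h1 := h.inner_evalSeq hφ hz hz
  rw [inner_self_eq_norm_sq_to_K, mul_assoc, Complex.mul_conj', Complex.mul_conj'] at h1
  apply Complex.ofReal_injective
  push_cast
  exact h1

lemma tendstoLocallyUniformlyOn_truncEvalSeq (h : IsSzegoDensity μ ω) (hφ : IsOrthonormal μ φ) :
    TendstoLocallyUniformlyOn (truncEvalSeq φ) (evalSeq φ) atTop (Metric.ball 0 1) := by
  have hcont : ContinuousOn (fun z => ‖evalSeq φ z‖ ^ 2) (Metric.ball 0 1) := by
    have h1 : ContinuousOn (fun z : ℂ =>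
        ((1 - ‖z‖ ^ 2) * ‖outer (fun ζ => Real.log (ω ζ)) z‖ ^ 2)⁻¹) (Metric.ball 0 1) := by
      refine ContinuousOn.inv₀ (ContinuousOn.mul (by fun_prop)
        ((differentiableOn_outer h.log_integrable).continuousOn.norm.pow 2)) fun z hz => ?_
      have hz1 := mem_ball_zero_iff.mp hz
      have hD : 0 < ‖outer (fun ζ => Real.log (ω ζ)) z‖ := norm_pos_iff.mpr (outer_ne_zero _ _)
      have : 0 < 1 - ‖z‖ ^ 2 := by nlinarith [norm_nonneg z]
      positivity
    exact h1.congr fun z hz => h.norm_sq_evalSeq hφ (mem_ball_zero_iff.mp hz)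
  -- Dini applies because the explicit kernel makes the limit of the increasing sums continuous.
  have hdini := Monotone.tendstoLocallyUniformlyOn_of_forall_tendsto
    (F := fun n z => ∑ j ∈ Finset.range (n + 1), ‖(φ j).eval z‖ ^ 2)
    (f := fun z => ‖evalSeq φ z‖ ^ 2) (s := Metric.ball 0 1)
    (fun n => Continuous.continuousOn (continuous_finsetSum _ fun j _ =>
      ((φ j).continuous.norm.pow 2)))
    (fun z _ m n hmn => Finset.sum_le_sum_of_subset_of_nonneg
      (Finset.range_mono (by omega)) fun _ _ _ => by positivity)
    hcont (fun z hz => by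
      have h1 := (evalSeq φ z).hasSum_norm_sq
      simp only [evalSeq_apply (h.memℓp_eval hφ (mem_ball_zero_iff.mp hz))] at h1
      exact h1.tendsto_sum_nat.comp (tendsto_add_atTop_nat 1))
  rw [Metric.tendstoLocallyUniformlyOn_iff] at hdini ⊢
  intro ε hε z hz
  obtain ⟨t, ht, htε⟩ := hdini (ε ^ 2) (by positivity) z hz
  refine ⟨t ∩ Metric.ball 0 1, inter_mem ht self_mem_nhdsWithin, ?_⟩
  filter_upwards [htε] with n hn y hy
  have h1 := hn y hy.1
  rw [Real.dist_eq, ← norm_sq_evalSeq_sub_truncEvalSeq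
    (h.memℓp_eval hφ (mem_ball_zero_iff.mp hy.2)), abs_of_nonneg (by positivity)] at h1
  rw [dist_eq_norm]
  exact lt_of_pow_lt_pow_left₀ 2 hε.le h1

end IsSzegoDensity

/-- Locally uniform convergence is traded for joint convergence in `(n, z)`, so that quotients,
norms and exponentials are handled by ordinary limit rules; the next lemma trades it back. -/
lemma tendsto_prod_of_tendstoLocallyUniformlyOn {E : Type*} [PseudoMetricSpace E]
    {F : ℕ → ℂ → E} {f : ℂ → E} {U : Set ℂ} (hU : IsOpen U)
    (hF : TendstoLocallyUniformlyOn F f atTop U) (hf : ContinuousOn f U) {z : ℂ} (hz : z ∈ U) :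
    Tendsto (fun p : ℕ × ℂ => F p.1 p.2) (atTop ×ˢ 𝓝 z) (𝓝 (f z)) := by
  have h1 := hU.tendstoLocallyUniformlyOn_iff_forall_tendsto.mp hF z hz
  rw [tendsto_uniformity_iff_dist_tendsto_zero] at h1
  have h2 : Tendsto (fun p : ℕ × ℂ => f p.2) (atTop ×ˢ 𝓝 z) (𝓝 (f z)) :=
    (hf.continuousAt (hU.mem_nhds hz)).tendsto.comp tendsto_snd
  exact h2.congr_dist h1

lemma tendstoLocallyUniformlyOn_of_tendsto_prod {E : Type*} [UniformSpace E]
    {F : ℕ → ℂ → E} {f : ℂ → E} {U : Set ℂ} (hU : IsOpen U)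
    (hF : ∀ z ∈ U, Tendsto (fun p : ℕ × ℂ => F p.1 p.2) (atTop ×ˢ 𝓝 z) (𝓝 (f z)))
    (hf : ContinuousOn f U) : TendstoLocallyUniformlyOn F f atTop U := by
  refine hU.tendstoLocallyUniformlyOn_iff_forall_tendsto.mpr fun z hz => ?_
  have h2 : Tendsto (fun p : ℕ × ℂ => f p.2) (atTop ×ˢ 𝓝 z) (𝓝 (f z)) :=
    (hf.continuousAt (hU.mem_nhds hz)).tendsto.comp tendsto_snd
  exact (h2.prodMk_nhds (hF z hz)).mono_right (nhds_le_uniformity _)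

/-! ### Derivatives of the limit kernel. -/

section KernelDerivatives

variable {E : Type*} [NormedAddCommGroup E] [InnerProductSpace ℂ E] {Φ : ℂ → E} {D : ℂ → ℂ}

lemma one_sub_mul_conj_ne_zero {z w : ℂ} (hz : ‖z‖ < 1) (hw : ‖w‖ < 1) : 1 - z * conj w ≠ 0 := by
  intro h
  have h1 : ‖z * conj w‖ = 1 := by rw [← sub_eq_zero.mp h, norm_one]
  rw [norm_mul, RCLike.norm_conj] at h1
  nlinarith [norm_nonneg z, norm_nonneg w]

/-- A logarithmic derivative; `c` and `d` stand for `conj w` and `conj (D w)`, constant in the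
holomorphic variable. -/
lemma hasDerivAt_szegoKernel {z c d : ℂ} (hD : DifferentiableAt ℂ D z) (hDz : D z ≠ 0)
    (hz : 1 - z * c ≠ 0) (hd : d ≠ 0) :
    HasDerivAt (fun ξ => ((1 - ξ * c) * D ξ * d)⁻¹)
      (((1 - z * c) * D z * d)⁻¹ * (c / (1 - z * c) - deriv D z / D z)) z := by
  have h1 : HasDerivAt (fun ξ => (1 - ξ * c) * D ξ * d)
      ((-c * D z + (1 - z * c) * deriv D z) * d) z := by
    have h0 : HasDerivAt (fun ξ : ℂ => 1 - ξ * c) (-c) z := by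
      simpa using ((hasDerivAt_id z).mul_const c).const_sub 1
    exact (h0.mul hD.hasDerivAt).mul_const d
  refine (h1.fun_inv (mul_ne_zero (mul_ne_zero hz hDz) hd)).congr_deriv ?_
  generalize 1 - z * c = u at hz
  field_simp
  ring

lemma hasDerivAt_inner_right {z : ℂ} (x : E) (hΦ : DifferentiableAt ℂ Φ z) :
    HasDerivAt (fun ξ => inner ℂ x (Φ ξ)) (inner ℂ x (deriv Φ z)) z :=
  (innerSL ℂ x).hasFDerivAt.comp_hasDerivAt z hΦ.hasDerivAt

variable (hΦ : DifferentiableOn ℂ Φ (Metric.ball 0 1)) (hD : DifferentiableOn ℂ D (Metric.ball 0 1))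
  (hD0 : ∀ z, D z ≠ 0)
  (hK : ∀ z w : ℂ, ‖z‖ < 1 → ‖w‖ < 1 →
    inner ℂ (Φ w) (Φ z) = ((1 - z * conj w) * D z * conj (D w))⁻¹)

include hΦ hD hD0 hK

lemma inner_deriv_right {z w : ℂ} (hz : ‖z‖ < 1) (hw : ‖w‖ < 1) :
    inner ℂ (Φ w) (deriv Φ z) = ((1 - z * conj w) * D z * conj (D w))⁻¹ *
      (conj w / (1 - z * conj w) - deriv D z / D z) := by
  have hnhds : Metric.ball (0 : ℂ) 1 ∈ 𝓝 z := Metric.isOpen_ball.mem_nhds (mem_ball_zero_iff.mpr hz)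
  have h1 := hasDerivAt_inner_right (Φ w) (hΦ.differentiableAt hnhds)
  have h2 := hasDerivAt_szegoKernel (hD.differentiableAt hnhds) (hD0 z)
    (one_sub_mul_conj_ne_zero hz hw) ((map_ne_zero (starRingEnd ℂ)).mpr (hD0 w))
  refine h1.unique (h2.congr_of_eventuallyEq ?_)
  filter_upwards [hnhds] with ξ hξ
  exact hK ξ w (mem_ball_zero_iff.mp hξ) hw

lemma inner_deriv_left {z w : ℂ} (hz : ‖z‖ < 1) (hw : ‖w‖ < 1) :
    inner ℂ (deriv Φ z) (Φ w) = ((1 - w * conj z) * D w * conj (D z))⁻¹ *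
      (w / (1 - w * conj z) - conj (deriv D z) / conj (D z)) := by
  rw [← inner_conj_symm, inner_deriv_right hΦ hD hD0 hK hz hw]
  simp only [map_mul, map_inv₀, map_sub, map_div₀, map_one, Complex.conj_conj]
  ring

/-- The formula of `inner_deriv_left` is holomorphic in its second point, so it can be
differentiated there and evaluated on the diagonal. The product rule gives the extra `1/(1-|z|²)²`.
-/
lemma inner_deriv_deriv {z : ℂ} (hz : ‖z‖ < 1) :
    inner ℂ (deriv Φ z) (deriv Φ z) = ((1 - z * conj z) * D z * conj (D z))⁻¹ *
      ((conj z / (1 - z * conj z) - deriv D z / D z) *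
        (z / (1 - z * conj z) - conj (deriv D z) / conj (D z)) + 1 / (1 - z * conj z) ^ 2) := by
  have hnhds : Metric.ball (0 : ℂ) 1 ∈ 𝓝 z := Metric.isOpen_ball.mem_nhds (mem_ball_zero_iff.mpr hz)
  have hne := one_sub_mul_conj_ne_zero hz hz
  have h1 := hasDerivAt_inner_right (deriv Φ z) (hΦ.differentiableAt hnhds)
  have h2 := hasDerivAt_szegoKernel (hD.differentiableAt hnhds) (hD0 z) hne
    ((map_ne_zero (starRingEnd ℂ)).mpr (hD0 z))
  have h3 : HasDerivAt (fun ξ : ℂ => ξ / (1 - ξ * conj z) - conj (deriv D z) / conj (D z))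
      (1 / (1 - z * conj z) ^ 2) z := by
    have h0 : HasDerivAt (fun ξ : ℂ => 1 - ξ * conj z) (-conj z) z := by
      simpa using ((hasDerivAt_id z).mul_const (conj z)).const_sub 1
    refine (((hasDerivAt_id' z).fun_div h0 hne).sub_const _).congr_deriv ?_
    ring
  refine (h1.unique ((h2.mul h3).congr_of_eventuallyEq ?_)).trans (by ring)
  filter_upwards [hnhds] with ξ hξ
  exact inner_deriv_left hΦ hD hD0 hK hz (mem_ball_zero_iff.mp hξ)

end KernelDerivatives

lemma kernel_eq_inner (φ : ℕ → ℂ[X]) (n k l : ℕ) (z w : ℂ) :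
    kernel φ n k l z w = inner ℂ (truncEvalSeq (fun j => Polynomial.derivative^[l] (φ j)) n w)
      (truncEvalSeq (fun j => Polynomial.derivative^[k] (φ j)) n z) := by
  rw [inner_truncEvalSeq, kernel]

lemma deriv_truncEvalSeq (φ : ℕ → ℂ[X]) (n : ℕ) :
    deriv (truncEvalSeq φ n) = truncEvalSeq (fun j => Polynomial.derivative (φ j)) n :=
  funext fun z => (hasDerivAt_truncEvalSeq n z).deriv

end OPUC

end

/-! ### Convergence of the density. -/

theorem theorem6p1 (μ : Measure Circle) (W : ℝ → ℝ) (hμ : OPUC.IsSzegoClass μ W)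
    (φ : ℕ → ℂ[X]) (hφ : OPUC.IsOrthonormal μ φ) (v : ℂ) :
    TendstoLocallyUniformlyOn (fun (n : ℕ) (z : ℂ) => OPUC.rho φ n v z)
      (fun z : ℂ =>
        (1 / Real.pi) *
          (1 / (1 - ‖z‖ ^ 2) ^ 2
            + (1 - ‖z‖ ^ 2) * ‖v * OPUC.szegoFunction W z‖ ^ 2
              * ‖z / (1 - (‖z‖ : ℂ) ^ 2)
                  - conj (deriv (OPUC.szegoFunction W) z) / conj (OPUC.szegoFunction W z)‖ ^ 2)
          * Real.exp (-((1 - ‖z‖ ^ 2) * ‖v * OPUC.szegoFunction W z‖ ^ 2)))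
      atTop (Metric.ball (0 : ℂ) 1) := by
  obtain ⟨ω, hω, hD⟩ := hμ.exists_density
  have hDeq : OPUC.szegoFunction W = OPUC.outer fun ζ => Real.log (ω ζ) := funext hD
  rw [hDeq]
  set D := OPUC.outer fun ζ => Real.log (ω ζ) with hDdef
  have hDd : DifferentiableOn ℂ D (Metric.ball 0 1) := OPUC.differentiableOn_outer hω.log_integrable
  have hD0 : ∀ z, D z ≠ 0 := OPUC.outer_ne_zero _
  have hD' : ContinuousOn (deriv D) (Metric.ball 0 1) :=
    (hDd.deriv Metric.isOpen_ball).continuousOn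
  have hu := hω.tendstoLocallyUniformlyOn_truncEvalSeq hφ
  have htd : ∀ᶠ n in atTop, DifferentiableOn ℂ (OPUC.truncEvalSeq φ n) (Metric.ball 0 1) :=
    Eventually.of_forall fun n z _ =>
      (OPUC.hasDerivAt_truncEvalSeq n z).differentiableAt.differentiableWithinAt
  have hΦ := hu.differentiableOn htd Metric.isOpen_ball
  -- Weierstrass: locally uniform limits of holomorphic ℓ²-valued maps may be differentiated.
  have hu' := hu.deriv htd Metric.isOpen_ball
  have hΦ' := (hΦ.deriv Metric.isOpen_ball).continuousOn
  have hK : ∀ z w : ℂ, ‖z‖ < 1 → ‖w‖ < 1 → inner ℂ (OPUC.evalSeq φ w) (OPUC.evalSeq φ z) =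
      ((1 - z * conj w) * D z * conj (D w))⁻¹ := fun z w hz hw => hω.inner_evalSeq hφ hz hw
  refine OPUC.tendstoLocallyUniformlyOn_of_tendsto_prod Metric.isOpen_ball (fun z hz => ?_) ?_
  · have hz1 := mem_ball_zero_iff.mp hz
    have t0 := OPUC.tendsto_prod_of_tendstoLocallyUniformlyOn Metric.isOpen_ball hu
      hΦ.continuousOn hz
    have t1 := OPUC.tendsto_prod_of_tendstoLocallyUniformlyOn Metric.isOpen_ball hu' hΦ' hz
    simp only [Function.comp_apply, OPUC.deriv_truncEvalSeq] at t1
    set s : ℝ := 1 - ‖z‖ ^ 2 with hs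
    have hs0 : 0 < s := by nlinarith [norm_nonneg z]
    have hsz : 1 - z * conj z = (s : ℂ) := by rw [Complex.mul_conj', hs]; push_cast; ring
    set B : ℂ := z / (1 - (‖z‖ : ℂ) ^ 2) - conj (deriv D z) / conj (D z) with hB
    have hsz' : 1 - (‖z‖ : ℂ) ^ 2 = s := by rw [hs]; push_cast; ring
    have hBconj : conj z / (s : ℂ) - deriv D z / D z = conj B := by
      rw [hB, hsz']; simp
    have hr0 : 0 < ‖D z‖ := norm_pos_iff.mpr (hD0 z)
    -- The limit of `K_n(z,z)`; the other two kernels tend to `κ B` and `κ (|B|² + 1/s²)`.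
    set κ : ℝ := (s * ‖D z‖ ^ 2)⁻¹ with hκ
    have hκ0 : 0 < κ := by positivity
    have hκc : ((1 - z * conj z) * D z * conj (D z))⁻¹ = (κ : ℂ) := by
      rw [hsz, mul_assoc, Complex.mul_conj', hκ]; push_cast; ring
    have e00 : inner ℂ (OPUC.evalSeq φ z) (OPUC.evalSeq φ z) = (κ : ℂ) := by
      rw [hK z z hz1 hz1, hκc]
    have e01 : inner ℂ (deriv (OPUC.evalSeq φ) z) (OPUC.evalSeq φ z) = κ * B := by
      rw [OPUC.inner_deriv_left hΦ hDd hD0 hK hz1 hz1, hκc, hsz, hB, hsz']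
    have e11 : inner ℂ (deriv (OPUC.evalSeq φ) z) (deriv (OPUC.evalSeq φ) z) =
        ((κ * (‖B‖ ^ 2 + 1 / s ^ 2) : ℝ) : ℂ) := by
      rw [OPUC.inner_deriv_deriv hΦ hDd hD0 hK hz1, hκc, hsz, hBconj, ← hsz', ← hB,
        Complex.conj_mul', hsz']
      push_cast
      ring
    have k00 : Tendsto (fun p : ℕ × ℂ => (OPUC.kernel φ p.1 0 0 p.2 p.2).re)
        (atTop ×ˢ 𝓝 z) (𝓝 κ) := by
      have h1 := (Complex.continuous_re.tendsto _).comp (t0.inner (𝕜 := ℂ) t0)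
      rw [e00, Complex.ofReal_re] at h1
      exact h1.congr fun p => by simp [OPUC.kernel_eq_inner]
    have k01 : Tendsto (fun p : ℕ × ℂ => ‖OPUC.kernel φ p.1 0 1 p.2 p.2‖)
        (atTop ×ˢ 𝓝 z) (𝓝 (κ * ‖B‖)) := by
      have h1 := (t1.inner (𝕜 := ℂ) t0).norm
      rw [e01, norm_mul, Complex.norm_real, Real.norm_of_nonneg hκ0.le] at h1
      exact h1.congr fun p => by simp [OPUC.kernel_eq_inner]
    have k11 : Tendsto (fun p : ℕ × ℂ => (OPUC.kernel φ p.1 1 1 p.2 p.2).re)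
        (atTop ×ˢ 𝓝 z) (𝓝 (κ * (‖B‖ ^ 2 + 1 / s ^ 2))) := by
      have h1 := (Complex.continuous_re.tendsto _).comp (t1.inner (𝕜 := ℂ) t1)
      rw [e11, Complex.ofReal_re] at h1
      exact h1.congr fun p => by simp [OPUC.kernel_eq_inner]
    have hv : Tendsto (fun p : ℕ × ℂ => ‖v‖ ^ 2 / (OPUC.kernel φ p.1 0 0 p.2 p.2).re)
        (atTop ×ˢ 𝓝 z) (𝓝 (‖v‖ ^ 2 / κ)) := tendsto_const_nhds.div k00 hκ0.ne'
    have hlim := (((k11.div k00 hκ0.ne').sub (((k01.pow 2).div (k00.pow 2)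
      (pow_ne_zero 2 hκ0.ne')).mul (hv.const_sub 1))).const_mul (1 / Real.pi)).mul
        ((Real.continuous_exp.tendsto _).comp hv.neg)
    have hvκ : ‖v‖ ^ 2 / κ = s * ‖v * D z‖ ^ 2 := by
      rw [hκ, norm_mul]
      field_simp
    rw [hvκ] at hlim
    -- The two `|B|²` terms cancel, leaving `1/s²` and the `|B|²` term weighted by `|v|²/κ`.
    have hval : κ * (‖B‖ ^ 2 + 1 / s ^ 2) / κ
        - (κ * ‖B‖) ^ 2 / κ ^ 2 * (1 - s * ‖v * D z‖ ^ 2) =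
          1 / s ^ 2 + s * ‖v * D z‖ ^ 2 * ‖B‖ ^ 2 := by
      field_simp
      ring
    rw [hval] at hlim
    exact hlim
  · have hne : ∀ z ∈ Metric.ball (0 : ℂ) 1, 1 - ‖z‖ ^ 2 ≠ 0 := fun z hz => by
      have := mem_ball_zero_iff.mp hz
      nlinarith [norm_nonneg z]
    have hne' : ∀ z ∈ Metric.ball (0 : ℂ) 1, 1 - (‖z‖ : ℂ) ^ 2 ≠ 0 := fun z hz => by
      have := hne z hz
      exact_mod_cast this
    have hDc := hDd.continuousOn
    have hconj : ∀ {f : ℂ → ℂ}, ContinuousOn f (Metric.ball 0 1) →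
        ContinuousOn (fun z => conj (f z)) (Metric.ball 0 1) := fun hf =>
      Complex.continuous_conj.comp_continuousOn hf
    have hE : ContinuousOn (fun z : ℂ => (1 - ‖z‖ ^ 2) * ‖v * D z‖ ^ 2) (Metric.ball 0 1) :=
      ContinuousOn.mul (by fun_prop) ((continuousOn_const.mul hDc).norm.pow 2)
    have hB : ContinuousOn (fun z : ℂ => z / (1 - (‖z‖ : ℂ) ^ 2)
        - conj (deriv D z) / conj (D z)) (Metric.ball 0 1) :=
      (continuousOn_id.div (by fun_prop) hne').sub
        ((hconj hD').div (hconj hDc) fun z _ => (map_ne_zero _).mpr (hD0 z))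
    exact (continuousOn_const.mul ((continuousOn_const.div (by fun_prop)
      fun z hz => pow_ne_zero 2 (hne z hz)).add (hE.mul (hB.norm.pow 2)))).mul hE.neg.rexp
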